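/- Let $n\ge 1$. Let $H=-\Delta+|x|^2$ be the Hermite operator on $\mathbb{R}^n$ and, for $k=0,1,2,\dots$ and $f\in L^2(\mathbb{R}^n)$ (complex valued), let $P_kf$ be the orthogonal projection of $f$ onto the eigenspace of $H$ in $L^2(\mathbb{R}^n)$ with eigenvalue $2k+n$. Let $L_k^{n-1}(t)=\sum_{i=0}^k(-1)^i\binom{k+n-1}{k-i}\frac{t^i}{i!}$ be the Laguerre polynomials of type $n-1$ and define the Laguerre functions on $\mathbb{C}^n$ by $$\varphi_k^{n-1}(z)=L_k^{n-1}\!\left(\tfrac12 z^2\right)e^{-\frac14 z^2},\qquad z^2=\sum_{j=1}^n z_j^2,$$ so that $\varphi_k^{n-1}(2iy)=L_k^{n-1}(-2|y|^2)e^{|y|^2}>0$ for $y\in\mathbb{R}^n$. **Theorem (Beurling–Hermite).** There is no nonzero $f\in L^2(\mathbb{R}^n)$ for which $$\sum_{k=0}^\infty\int_{\mathbb{R}^n}|f(y)|\,\|P_kf\|_2\,\sqrt{\varphi_k^{n-1}(2iy)}\;dy<\infty .$$ -/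

import Mathlib

open MeasureTheory
open scoped SchwartzMap

noncomputable section

/-- The Euclidean space `ℝⁿ`. -/
abbrev RSpace (n : ℕ) : Type := EuclideanSpace ℝ (Fin n)

/-- The Hilbert space `L²(ℝⁿ)` of complex-valued functions, with respect to Lebesgue measure. -/
abbrev L2Space (n : ℕ) : Type := Lp ℂ 2 (volume : Measure (RSpace n))

/-- The Hermite operator `H = -Δ + |x|²`, acting on tempered distributions. -/
def hermiteOperator (n : ℕ) : 𝓢'(RSpace n, ℂ) →L[ℂ] 𝓢'(RSpace n, ℂ) :=
  -LineDeriv.laplacianCLM ℂ (RSpace n) 𝓢'(RSpace n, ℂ) +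
    TemperedDistribution.smulLeftCLM ℂ (fun x : RSpace n => ((‖x‖ ^ 2 : ℝ) : ℂ))

/-- The operator is given by duality: `⟨H u, ψ⟩ = ⟨u, χ⟩` as soon as the Schwartz function `χ`
is `-Δψ + |x|² ψ`. -/
theorem hermiteOperator_apply (n : ℕ) (u : 𝓢'(RSpace n, ℂ)) (ψ χ : 𝓢(RSpace n, ℂ))
    (hχ : ∀ x, χ x = -(Laplacian.laplacian ψ) x + ((‖x‖ ^ 2 : ℝ) : ℂ) * ψ x) :
    hermiteOperator n u ψ = u χ := by
  have hg : (fun x : RSpace n => ((‖x‖ ^ 2 : ℝ) : ℂ)).HasTemperateGrowth := by fun_prop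
  have h : χ = -Laplacian.laplacian ψ +
      SchwartzMap.smulLeftCLM ℂ (fun x : RSpace n => ((‖x‖ ^ 2 : ℝ) : ℂ)) ψ := by
    ext x
    rw [hχ, add_apply, SchwartzMap.smulLeftCLM_apply_apply hg]
    simp
  rw [h, map_add, map_neg, hermiteOperator, add_apply,
    neg_apply, TemperedDistribution.laplacianCLM_apply]
  change -(Laplacian.laplacian u) ψ + _ = _
  rw [TemperedDistribution.laplacian_apply_apply]
  rfl

/-- The eigenspace in `L²(ℝⁿ)` of the Hermite operator with eigenvalue `2k + n`, i.e. the space of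
all `g ∈ L²(ℝⁿ)` with `H g = (2k + n) g` in the sense of tempered distributions. -/
def hermiteEigenspace (n k : ℕ) : Submodule ℂ (L2Space n) :=
  ((hermiteOperator n - (2 * k + n : ℂ) • ContinuousLinearMap.id ℂ 𝓢'(RSpace n, ℂ)) ∘L
    Lp.toTemperedDistributionCLM ℂ (volume : Measure (RSpace n)) 2).ker

theorem mem_hermiteEigenspace_iff (n k : ℕ) (g : L2Space n) :
    g ∈ hermiteEigenspace n k ↔
      hermiteOperator n (Lp.toTemperedDistribution g) =
        (2 * k + n : ℂ) • Lp.toTemperedDistribution g := by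
  simp [hermiteEigenspace, sub_eq_zero]

instance hermiteEigenspace_completeSpace (n k : ℕ) : CompleteSpace (hermiteEigenspace n k) :=
  IsClosed.completeSpace_coe (hs := ContinuousLinearMap.isClosed_ker
    ((hermiteOperator n - (2 * k + n : ℂ) • ContinuousLinearMap.id ℂ 𝓢'(RSpace n, ℂ)) ∘L
      Lp.toTemperedDistributionCLM ℂ (volume : Measure (RSpace n)) 2))

/-- The Hermite projection `P_k`: the orthogonal projection of `L²(ℝⁿ)` onto the eigenspace of the
Hermite operator with eigenvalue `2k + n`. -/
def hermiteProj (n k : ℕ) : L2Space n →L[ℂ] L2Space n :=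
  (hermiteEigenspace n k).starProjection

/-- The Laguerre polynomial `L_k^a(t) = ∑_{i ≤ k} (-1)^i C(k + a, k - i) t^i / i!` of type
`a ∈ ℕ`, as a function of a complex variable. -/
def laguerre (a k : ℕ) (t : ℂ) : ℂ :=
  ∑ i ∈ Finset.range (k + 1), (-1) ^ i * ((k + a).choose (k - i) : ℂ) * t ^ i / (i.factorial : ℂ)

/-- The Laguerre function `φ_k^a(z) = L_k^a(z² / 2) exp(-z² / 4)` on `ℂⁿ`, where
`z² = ∑ j, z_j²`. -/
def laguerreFun {n : ℕ} (a k : ℕ) (z : Fin n → ℂ) : ℂ :=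
  laguerre a k ((1 / 2) * ∑ j, z j ^ 2) * Complex.exp (-(1 / 4) * ∑ j, z j ^ 2)

/-- The point `2iy ∈ ℂⁿ` for `y ∈ ℝⁿ`. -/
def twoI {n : ℕ} (y : RSpace n) : Fin n → ℂ := fun j => 2 * Complex.I * (y j : ℂ)

/-- At points `2iy` with `y` real, the Laguerre function takes a real nonnegative value, so that
nothing is lost by taking its real part. -/
theorem laguerreFun_twoI {n : ℕ} (a k : ℕ) (y : RSpace n) :
    0 ≤ (laguerreFun a k (twoI y)).re ∧ (laguerreFun a k (twoI y)).im = 0 := by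
  have hs : ∑ j, twoI y j ^ 2 = ((-(4 * ‖y‖ ^ 2) : ℝ) : ℂ) := by
    rw [EuclideanSpace.real_norm_sq_eq, Finset.mul_sum, ← Finset.sum_neg_distrib]
    push_cast
    refine Finset.sum_congr rfl fun j _ => ?_
    simp only [twoI, mul_pow, Complex.I_sq]
    ring
  have h : laguerreFun a k (twoI y) =
      (((∑ i ∈ Finset.range (k + 1),
        ((k + a).choose (k - i) : ℝ) * (2 * ‖y‖ ^ 2) ^ i / (i.factorial : ℝ)) *
          Real.exp (‖y‖ ^ 2) : ℝ) : ℂ) := by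
    rw [laguerreFun, hs, laguerre]
    push_cast
    congr 1
    · refine Finset.sum_congr rfl fun i _ => ?_
      rw [show (1 / 2 : ℂ) * (-(4 * (‖y‖ : ℂ) ^ 2)) = (-1) * (2 * (‖y‖ : ℂ) ^ 2) by ring, mul_pow,
        show ∀ b c : ℂ, (-1) ^ i * b * ((-1) ^ i * c) = ((-1) * (-1)) ^ i * (b * c) by
          intro b c; rw [mul_pow]; ring]
      simp
    · congr 1
      ring
  rw [h]
  refine ⟨?_, Complex.ofReal_im _⟩
  rw [Complex.ofReal_re]
  positivity

end

/-! ### One complex variable: Beurling's theorem for entire functions of order two. -/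

section
open MeasureTheory Filter Topology Complex Set
open scoped Real

/-! For a unit vector `ω`, integrate `f` against the generating function of the Hermite polynomials
in `ω · x`, with Gaussian weight. The result `G = bargmann f ω` is a Bargmann transform on a complex
line, and it can be estimated in two ways.

Everywhere: its `k`-th Taylor coefficient pairs `f` with an eigenfunction of eigenvalue `2k + n`,
hence sees only `P_k f`. This gives `|G(τ)| ≤ m(|τ|)`, where `m` is a power series with weights
`‖P_k f‖` that does not depend on `ω` (`enorm_bargmann_le`). On the real line: completing the square
gives `|G(r)| ≤ Γ(rω)`, where `Γ` is the convolution of `|f| exp(|x|²/2)` with `exp(-|x|²)`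
(`enorm_bargmann_ofReal_le`).

The Laguerre weight enters when `Γ(u) m(|u|)` is integrated over `ℝⁿ`. The `k`-th term contains the
`k`-th absolute moment of a Gaussian centred at `x`. Its square is a double integral; a rotation of
`ℝⁿ × ℝⁿ` and `2|u||v| ≤ |u|² + |v|²` bound it by a moment of a shifted Gaussian in dimension `2n`,
which is a multiple of `L_k^{n-1}(-2|x|²)` (`sq_lintegral_norm_pow_mul_gaussian_le`). So the
hypothesis makes `Γ(u) m(|u|)` integrable, and in polar coordinates `|G(±r)| m(r)` is integrable on
the half-line for almost every `ω`.

For such `ω`, Beurling's argument (`IsBeurling.eq_zero`) applies: the primitive of `G(z) G(iz)` is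
bounded on the four coordinate half-axes, so bounded by Phragmén–Lindelöf, so constant by Liouville;
hence `G = 0`. On the imaginary axis `G` is, up to a nonzero factor, the Fourier transform of `f
exp(-|x|²/2)` along `ω`, so `f = 0`. -/

theorem PhragmenLindelof.sector {Φ : ℂ → ℂ} (hd : Differentiable ℂ Φ) {C B K a b : ℝ}
    (hB : ∀ z, ‖Φ z‖ ≤ C * Real.exp (B * ‖z‖ ^ 2)) (hab : b - a < π / 2)
    (ha : ∀ r : ℝ, 0 < r → ‖Φ (r * exp (a * I))‖ ≤ K)
    (hb : ∀ r : ℝ, 0 < r → ‖Φ (r * exp (b * I))‖ ≤ K)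
    {θ r : ℝ} (haθ : a ≤ θ) (hθb : θ ≤ b) (hr : 0 < r) : ‖Φ (r * exp (θ * I))‖ ≤ K := by
  rcases haθ.eq_or_lt with rfl | haθ'
  · exact ha r hr
  have hexp : ∀ z : ℂ, exp z = (Real.exp z.re : ℝ) * exp (z.im * I) := fun z => by
    rw [ofReal_exp, ← exp_add, re_add_im]
  have hsum : exp ((Real.log r : ℝ) + θ * I) = r * exp (θ * I) := by
    rw [exp_add, ← ofReal_exp, Real.exp_log hr]
  have key : ‖(Φ ∘ exp) ((Real.log r : ℝ) + θ * I)‖ ≤ K := by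
    -- The exponential maps a strip of width `b - a` onto the sector; order two becomes growth
    -- `exp(|B| exp(2|Re z|))`, admissible because `2 < π / (b - a)`.
    refine PhragmenLindelof.horizontal_strip (a := a) (b := b)
      (hd.comp differentiable_exp).diffContOnCl ⟨2, ?_, |B|, ?_⟩ ?_ ?_ (by simpa) (by simpa)
    · rw [lt_div_iff₀ (by linarith)]; linarith
    · refine Asymptotics.IsBigO.of_bound C (Eventually.of_forall fun z => ?_)
      have hC : 0 ≤ C := by
        have := (norm_nonneg _).trans (hB 0)
        simpa using this
      refine (hB _).trans ?_
      rw [Real.norm_of_nonneg (Real.exp_nonneg _), norm_exp, ← Real.exp_nat_mul, Nat.cast_ofNat]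
      gcongr
      · exact le_abs_self B
      · exact le_abs_self z.re
    · intro z hz
      rw [Function.comp_apply, hexp, hz]
      exact ha _ (Real.exp_pos _)
    · intro z hz
      rw [Function.comp_apply, hexp, hz]
      exact hb _ (Real.exp_pos _)
  rwa [Function.comp_apply, hsum] at key

/-- The primitive of `H` which vanishes at the origin, as an integral over the segment `[0, z]`. -/
noncomputable def radialPrimitive (H : ℂ → ℂ) (z : ℂ) : ℂ := ∫ t in (0 : ℝ)..1, z * H (t * z)

/-- An entire function has a primitive vanishing at `0`; the fundamental theorem of calculus along
`[0, z]` identifies it with the radial integral. -/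
theorem hasDerivAt_radialPrimitive {H : ℂ → ℂ} (hH : Differentiable ℂ H) (z : ℂ) :
    HasDerivAt (radialPrimitive H) (H z) z := by
  obtain ⟨g, hg0, hg⟩ := hH.isExactOn_univ.with_val_at 0 0
  have : radialPrimitive H = g := by
    funext w
    have h := intervalIntegral.integral_eq_sub_of_hasDerivAt (a := 0) (b := 1)
      (f := fun t : ℝ => g (t * w)) (f' := fun t : ℝ => w * H (t * w)) (fun t _ => by
        have h1 : HasDerivAt (fun t : ℝ => (t : ℂ) * w) w t := by
          simpa using (ofRealCLM.hasDerivAt (x := t)).mul_const w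
        simpa only [mul_comm, Function.comp_def] using (hg (t * w) trivial).comp t h1)
      ((continuous_const.mul (hH.continuous.comp (by fun_prop))).intervalIntegrable _ _)
    simp only [ofReal_one, one_mul, ofReal_zero, zero_mul, hg0, sub_zero] at h
    exact h
  rw [this]
  exact hg z trivial

theorem norm_radialPrimitive_le {H : ℂ → ℂ} {M : ℝ} {z : ℂ} (h : ∀ w, ‖w‖ ≤ ‖z‖ → ‖H w‖ ≤ M) :
    ‖radialPrimitive H z‖ ≤ ‖z‖ * M := by
  refine (intervalIntegral.norm_integral_le_of_norm_le_const (C := ‖z‖ * M) fun t ht => ?_).trans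
    (by simp)
  rw [uIoc_of_le zero_le_one] at ht
  rw [norm_mul]
  gcongr
  refine h _ ?_
  rw [norm_mul, norm_real, Real.norm_of_nonneg ht.1.le]
  exact mul_le_of_le_one_left (norm_nonneg _) ht.2

theorem norm_radialPrimitive_ray_le {H : ℂ → ℂ} {K : ENNReal} (hK : K ≠ ⊤)
    {e : ℂ} (he : ‖e‖ = 1) (h : ∫⁻ t in Ioi (0 : ℝ), ‖H (t * e)‖ₑ ≤ K) {r : ℝ} (hr : 0 < r) :
    ‖radialPrimitive H (r * e)‖ ≤ K.toReal := by
  have h1 : radialPrimitive H (r * e) = ∫ t in (0 : ℝ)..r, e * H (t * e) := by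
    have := intervalIntegral.smul_integral_comp_mul_right (a := 0) (b := 1)
      (fun t : ℝ => e * H (t * e)) r
    rw [zero_mul, one_mul] at this
    rw [← this, radialPrimitive, ← intervalIntegral.integral_smul]
    refine intervalIntegral.integral_congr fun t _ => ?_
    simp only [real_smul]
    push_cast
    ring_nf
  rw [← toReal_enorm]
  refine ENNReal.toReal_mono hK (le_trans ?_ h)
  rw [h1, intervalIntegral.integral_of_le hr.le]
  refine (enorm_integral_le_lintegral_enorm _).trans ?_
  refine (lintegral_mono_set Ioc_subset_Ioi_self).trans (lintegral_mono fun t => ?_)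
  simp [← ofReal_norm, he]

/-- The hypotheses of the one-dimensional Beurling argument: `G` is entire of order two and is
integrable against a radial majorant of itself on the real line. -/
structure IsBeurling (G : ℂ → ℂ) (m : ℝ → ENNReal) (C B : ℝ) : Prop where
  differentiable : Differentiable ℂ G
  growth : ∀ z, ‖G z‖ ≤ C * Real.exp (B * ‖z‖ ^ 2)
  majorant : ∀ z, ‖G z‖ₑ ≤ m ‖z‖
  integrable_pos : ∫⁻ r in Ioi (0 : ℝ), ‖G r‖ₑ * m r ≠ ⊤
  integrable_neg : ∫⁻ r in Ioi (0 : ℝ), ‖G (-r)‖ₑ * m r ≠ ⊤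

namespace IsBeurling

variable {G : ℂ → ℂ} {m : ℝ → ENNReal} {C B : ℝ}

/-- The product `G (e^{iβ} z) G (i z)`. -/
noncomputable def twisted (G : ℂ → ℂ) (β : ℝ) (z : ℂ) : ℂ := G (exp (β * I) * z) * G (I * z)

theorem differentiable_twisted (h : IsBeurling G m C B) (β : ℝ) :
    Differentiable ℂ (twisted G β) :=
  (h.differentiable.comp (differentiable_id.const_mul _)).mul
    (h.differentiable.comp (differentiable_id.const_mul _))

/-- A bound for the twisted primitives on the boundary rays. -/
noncomputable def bound (G : ℂ → ℂ) (m : ℝ → ENNReal) : ENNReal :=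
  (∫⁻ r in Ioi (0 : ℝ), ‖G r‖ₑ * m r) + ∫⁻ r in Ioi (0 : ℝ), ‖G (-r)‖ₑ * m r

theorem bound_ne_top (h : IsBeurling G m C B) : bound G m ≠ ⊤ :=
  ENNReal.add_ne_top.2 ⟨h.integrable_pos, h.integrable_neg⟩

/-- In each of these directions one factor of the product is evaluated on the real axis, and the
other is at most `m` at the same radius, so the integrability hypotheses apply. -/
theorem ray_le (h : IsBeurling G m C B) {β : ℝ} {e : ℂ} (he : ‖e‖ = 1)
    (hor : (exp (β * I) * e = 1 ∨ exp (β * I) * e = -1) ∨ (I * e = 1 ∨ I * e = -1))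
    {r : ℝ} (hr : 0 < r) : ‖radialPrimitive (twisted G β) (r * e)‖ ≤ (bound G m).toReal := by
  have hmaj : ∀ (c : ℂ) (t : ℝ), ‖c‖ = 1 → 0 < t → ‖G (c * (t * e))‖ₑ ≤ m t := by
    intro c t hc ht
    refine (h.majorant _).trans (le_of_eq ?_)
    rw [norm_mul, norm_mul, he, hc, norm_real, Real.norm_of_nonneg ht.le, mul_one, one_mul]
  refine norm_radialPrimitive_ray_le h.bound_ne_top he ?_ hr
  have hcomm : ∀ (c : ℂ) (t : ℝ), c * (t * e) = t * (c * e) := fun c t => by ring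
  have e1 : ‖exp (β * I)‖ = 1 := norm_exp_ofReal_mul_I β
  have e2 : ‖I‖ = 1 := norm_I
  rcases hor with (hc | hc) | (hc | hc)
  · refine le_trans (setLIntegral_mono_ae' measurableSet_Ioi (Eventually.of_forall fun t ht => ?_))
      le_self_add
    rw [twisted, enorm_mul, hcomm (exp _), hc, mul_one]
    gcongr
    exact hmaj _ _ e2 ht
  · refine le_trans (setLIntegral_mono_ae' measurableSet_Ioi (Eventually.of_forall fun t ht => ?_))
      le_add_self
    rw [twisted, enorm_mul, hcomm (exp _), hc, mul_neg_one]
    gcongr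
    exact hmaj _ _ e2 ht
  · refine le_trans (setLIntegral_mono_ae' measurableSet_Ioi (Eventually.of_forall fun t ht => ?_))
      le_self_add
    rw [twisted, enorm_mul, hcomm I, hc, mul_one, mul_comm]
    gcongr
    exact hmaj _ _ e1 ht
  · refine le_trans (setLIntegral_mono_ae' measurableSet_Ioi (Eventually.of_forall fun t ht => ?_))
      le_add_self
    rw [twisted, enorm_mul, hcomm I, hc, mul_neg_one, mul_comm]
    gcongr
    exact hmaj _ _ e1 ht

theorem norm_primitive_growth (h : IsBeurling G m C B) (hB : 0 ≤ B) (β : ℝ) (z : ℂ) :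
    ‖radialPrimitive (twisted G β) z‖ ≤ C ^ 2 * Real.exp ((2 * B + 1) * ‖z‖ ^ 2) := by
  have hC : 0 ≤ C := by simpa using (norm_nonneg _).trans (h.growth 0)
  have e1 : ‖exp (β * I)‖ = 1 := norm_exp_ofReal_mul_I β
  have h1 : ∀ w, ‖w‖ ≤ ‖z‖ →
      ‖twisted G β w‖ ≤ (C * Real.exp (B * ‖z‖ ^ 2)) * (C * Real.exp (B * ‖z‖ ^ 2)) := by
    intro w hw
    rw [twisted, norm_mul]
    gcongr
    · refine (h.growth _).trans ?_
      rw [norm_mul, e1, one_mul]; gcongr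
    · refine (h.growth _).trans ?_
      rw [norm_mul, norm_I, one_mul]; gcongr
  refine (norm_radialPrimitive_le h1).trans ?_
  -- The length of the segment is absorbed in the exponential, whence the `+ 1` in the exponent.
  have h2 : ‖z‖ ≤ Real.exp (‖z‖ ^ 2) := by
    nlinarith [Real.add_one_le_exp (‖z‖ ^ 2), sq_nonneg (‖z‖ - 1)]
  calc ‖z‖ * ((C * Real.exp (B * ‖z‖ ^ 2)) * (C * Real.exp (B * ‖z‖ ^ 2)))
      ≤ Real.exp (‖z‖ ^ 2) * ((C * Real.exp (B * ‖z‖ ^ 2)) * (C * Real.exp (B * ‖z‖ ^ 2))) := by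
        gcongr
    _ = C ^ 2 * (Real.exp (‖z‖ ^ 2) * Real.exp (B * ‖z‖ ^ 2) * Real.exp (B * ‖z‖ ^ 2)) := by ring
    _ = _ := by rw [← Real.exp_add, ← Real.exp_add]; ring_nf

theorem continuous_radialPrimitive_twisted (hG : Continuous G) (z : ℂ) :
    Continuous fun β : ℝ => radialPrimitive (twisted G β) z := by
  unfold radialPrimitive twisted
  apply intervalIntegral.continuous_parametric_intervalIntegral_of_continuous'
  fun_prop

theorem sector_le (h : IsBeurling G m C B) (hB : 0 ≤ B) {β a b : ℝ} (hab : b - a < π / 2)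
    (ha : (exp (β * I) * exp (a * I) = 1 ∨ exp (β * I) * exp (a * I) = -1) ∨
      (I * exp (a * I) = 1 ∨ I * exp (a * I) = -1))
    (hb : (exp (β * I) * exp (b * I) = 1 ∨ exp (β * I) * exp (b * I) = -1) ∨
      (I * exp (b * I) = 1 ∨ I * exp (b * I) = -1))
    {θ r : ℝ} (haθ : a ≤ θ) (hθb : θ ≤ b) (hr : 0 < r) :
    ‖radialPrimitive (twisted G β) (r * exp (θ * I))‖ ≤ (bound G m).toReal :=
  PhragmenLindelof.sector
    (fun z => (hasDerivAt_radialPrimitive (h.differentiable_twisted β) z).differentiableAt)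
    (h.norm_primitive_growth hB β) hab
    (fun _ hr => h.ray_le (norm_exp_ofReal_mul_I a) ha hr)
    (fun _ hr => h.ray_le (norm_exp_ofReal_mul_I b) hb hr) haθ hθb hr

/-- A full quadrant is just too wide for Phragmén–Lindelöf at order two. Twisting by `β = ±α` turns
the real ray into the quadrant by `α`, so its opening is `π / 2 - α`; the bound does not depend on
`α`, and `α → 0` by continuity in `β`. -/
theorem primitive_le (h : IsBeurling G m C B) (hB : 0 ≤ B) (z : ℂ) :
    ‖radialPrimitive (twisted G 0) z‖ ≤ (bound G m).toReal := by
  rcases eq_or_ne z 0 with rfl | hz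
  · simp [radialPrimitive]
  have hr : 0 < ‖z‖ := norm_pos_iff.2 hz
  have hlim : ∀ s : ℝ, Tendsto (fun α : ℝ => ‖radialPrimitive (twisted G (s * α)) z‖) (𝓝[>] 0)
      (𝓝 ‖radialPrimitive (twisted G 0) z‖) := fun s => by
    have := ((continuous_radialPrimitive_twisted h.differentiable.continuous z).comp
      (continuous_const.mul continuous_id : Continuous fun α : ℝ => s * α)).norm
    simpa using (this.tendsto 0).mono_left nhdsWithin_le_nhds
  have hI : exp ((π / 2 : ℝ) * I) = I := by push_cast; exact exp_pi_div_two_mul_I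
  have hI' : exp ((-(π / 2) : ℝ) * I) = -I := by
    push_cast; rw [neg_mul, exp_neg, exp_pi_div_two_mul_I, inv_I]
  have hpi := exp_pi_mul_I
  have hsmall : ∀ δ : ℝ, 0 < δ → ∀ᶠ α in 𝓝[>] (0 : ℝ), 0 < α ∧ α < δ := fun δ hδ =>
    Ioo_mem_nhdsGT hδ
  have harg := neg_pi_lt_arg z
  have harg' := arg_le_pi z
  have hz' : z = ‖z‖ * exp (arg z * I) := (norm_mul_exp_arg_mul_I z).symm
  rcases lt_trichotomy (arg z) 0 with h0 | h0 | h0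
  · rcases le_total (arg z) (-(π / 2)) with h1 | h1
    · refine le_of_tendsto (hlim (-1)) ?_
      filter_upwards [hsmall (arg z + π) (by linarith)] with α hα
      rw [hz']
      refine h.sector_le hB (a := -π + α) (b := -(π / 2)) (by linarith) (Or.inl (Or.inr ?_))
        (Or.inr (Or.inl ?_)) (by linarith) h1 hr
      · rw [← exp_add, ← exp_neg_pi_mul_I]; congr 1; push_cast; ring
      · rw [hI']; simp
    · refine le_of_tendsto (hlim 1) ?_
      filter_upwards [hsmall (-arg z) (by linarith)] with α hα
      rw [hz']
      refine h.sector_le hB (a := -(π / 2)) (b := -α) (by linarith)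
        (Or.inr (Or.inl ?_)) (Or.inl (Or.inl ?_)) h1 (by linarith) hr
      · rw [hI']; simp
      · rw [← exp_add, ← exp_zero]; congr 1; push_cast; ring
  · rw [hz', h0]
    exact h.ray_le (by simp) (Or.inl (Or.inl (by simp))) hr
  · rcases le_total (arg z) (π / 2) with h1 | h1
    · refine le_of_tendsto (hlim (-1)) ?_
      filter_upwards [hsmall (arg z) (by linarith)] with α hα
      rw [hz']
      refine h.sector_le hB (a := α) (b := π / 2) (by linarith) (Or.inl (Or.inl ?_))
        (Or.inr (Or.inr ?_)) (by linarith) h1 hr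
      · rw [← exp_add, ← exp_zero]; congr 1; push_cast; ring
      · rw [hI]; simp
    · rcases harg'.eq_or_lt with h2 | h2
      · rw [hz', h2, hpi]
        exact h.ray_le (by simp) (Or.inl (Or.inr (by simp))) hr
      refine le_of_tendsto (hlim 1) ?_
      filter_upwards [hsmall (π - arg z) (by linarith)] with α hα
      rw [hz']
      refine h.sector_le hB (a := π / 2) (b := π - α) (by linarith)
        (Or.inr (Or.inr ?_)) (Or.inl (Or.inr ?_)) h1 (by linarith) hr
      · rw [hI]; simp
      · rw [← exp_add, ← exp_pi_mul_I]; congr 1; push_cast; ring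

/-- **Beurling's theorem** for entire functions of order two. -/
theorem eq_zero (h : IsBeurling G m C B) (hB : 0 ≤ B) (z : ℂ) : G z = 0 := by
  have hder := hasDerivAt_radialPrimitive (h.differentiable_twisted 0)
  have hdiff : Differentiable ℂ (radialPrimitive (twisted G 0)) :=
    fun z => (hder z).differentiableAt
  have hbdd : Bornology.IsBounded (range (radialPrimitive (twisted G 0))) := by
    rw [isBounded_iff_forall_norm_le]
    exact ⟨_, by rintro _ ⟨z, rfl⟩; exact h.primitive_le hB z⟩
  have hprod : ∀ w, G w * G (I * w) = 0 := fun w => by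
    have h1 : radialPrimitive (twisted G 0) = fun _ => radialPrimitive (twisted G 0) 0 :=
      funext fun v => hdiff.apply_eq_apply_of_bounded hbdd v 0
    have h2 := hder w
    rw [h1] at h2
    simpa [twisted] using h2.unique (hasDerivAt_const w _)
  by_contra hne
  -- Near a point where `G` does not vanish the other factor must; the identity theorem spreads this
  -- to all of `ℂ`, and evaluation at `-I * z` contradicts `G z ≠ 0`.
  have hev : ∀ᶠ w in 𝓝 z, G (I * w) = 0 := by
    filter_upwards [h.differentiable.continuous.continuousAt.eventually_ne hne] with w hw
    exact (mul_eq_zero.1 (hprod w)).resolve_left hw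
  have han : AnalyticOnNhd ℂ (fun w => G (I * w)) univ :=
    ((h.differentiable.comp (differentiable_id.const_mul I)).differentiableOn).analyticOnNhd
      isOpen_univ
  have hz := han.eqOn_zero_of_preconnected_of_eventuallyEq_zero isPreconnected_univ
    (mem_univ z) hev (mem_univ (-I * z))
  simp only [Pi.zero_apply] at hz
  rw [← mul_assoc, mul_neg, I_mul_I, neg_neg, one_mul] at hz
  exact hne hz

end IsBeurling

end

/-! ### Laguerre generating function and Gaussian integrals. -/

section
open MeasureTheory Filter Topology Set
open scoped Real ENNReal

/-- The positive Laguerre-type polynomial `L_k^a(-t) = ∑_{i ≤ k} C(k + a, k - i) t^i / i!`. -/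
noncomputable def laguerreNeg (a k : ℕ) (t : ℝ) : ℝ :=
  ∑ i ∈ Finset.range (k + 1), ((k + a).choose (k - i) : ℝ) * t ^ i / (i.factorial : ℝ)

theorem laguerreNeg_nonneg (a k : ℕ) {t : ℝ} (ht : 0 ≤ t) : 0 ≤ laguerreNeg a k t :=
  Finset.sum_nonneg fun _ _ => by positivity

/-- Summation of a nonnegative double series along rows and along antidiagonals. -/
theorem hasSum_antidiagonal_of_nonneg {F : ℕ × ℕ → ℝ} (hF0 : ∀ p, 0 ≤ F p) {R : ℕ → ℝ} {T : ℝ}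
    (hrow : ∀ i, HasSum (fun j => F (i, j)) (R i)) (hcol : HasSum R T) :
    HasSum (fun k => ∑ p ∈ Finset.HasAntidiagonal.antidiagonal k, F p) T := by
  have hsF : Summable F := (summable_prod_of_nonneg hF0).2
    ⟨fun i => (hrow i).summable, by simpa only [(hrow _).tsum_eq] using hcol.summable⟩
  have htot : HasSum F T := by
    rw [← (hsF.hasSum.prod_fiberwise hrow).unique hcol]
    exact hsF.hasSum
  have hanti : HasSum (fun x : Σ k : ℕ, Finset.HasAntidiagonal.antidiagonal k =>
      F (Finset.HasAntidiagonal.sigmaAntidiagonalEquivProd x)) T :=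
    (Equiv.hasSum_iff Finset.HasAntidiagonal.sigmaAntidiagonalEquivProd).2 htot
  exact hanti.sigma (g := fun k => ∑ p ∈ Finset.HasAntidiagonal.antidiagonal k, F p) fun k =>
    (Finset.HasAntidiagonal.antidiagonal k).hasSum F

/-- The generating function of the Laguerre polynomials. -/
theorem hasSum_laguerreNeg (a : ℕ) {t r : ℝ} (ht : 0 ≤ t) (hr0 : 0 ≤ r) (hr1 : r < 1) :
    HasSum (fun k => r ^ k * laguerreNeg a k t)
      ((1 / (1 - r) ^ (a + 1)) * Real.exp (t * r / (1 - r))) := by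
  have h1r : 0 < 1 - r := by linarith
  have hcol : HasSum (fun i : ℕ => (t * r) ^ i / i.factorial * (1 / (1 - r) ^ (i + a + 1)))
      ((1 / (1 - r) ^ (a + 1)) * Real.exp (t * r / (1 - r))) := by
    have h : HasSum (fun i : ℕ => (t * r / (1 - r)) ^ i / i.factorial)
        (Real.exp (t * r / (1 - r))) := by
      rw [Real.exp_eq_exp_ℝ]
      exact NormedSpace.expSeries_div_hasSum_exp _
    have hfun : (fun i : ℕ => (t * r) ^ i / i.factorial * (1 / (1 - r) ^ (i + a + 1))) =
        fun i => 1 / (1 - r) ^ (a + 1) * ((t * r / (1 - r)) ^ i / i.factorial) := by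
      funext i
      rw [add_assoc, pow_add (1 - r) i, div_pow]
      field_simp
    rw [hfun]
    exact h.mul_left _
  have hrow : ∀ i : ℕ, HasSum (fun j : ℕ => (t * r) ^ i / i.factorial *
      (((j + (i + a)).choose (i + a) : ℝ) * r ^ j))
      ((t * r) ^ i / i.factorial * (1 / (1 - r) ^ (i + a + 1))) := fun i => by
    have h : HasSum (fun j : ℕ => ((j + (i + a)).choose (i + a) : ℝ) * r ^ j)
        (1 / (1 - r) ^ (i + a + 1)) :=
      hasSum_choose_mul_geometric_of_norm_lt_one (i + a) (by rwa [Real.norm_of_nonneg hr0])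
    exact h.mul_left _
  have hall := hasSum_antidiagonal_of_nonneg (F := fun p : ℕ × ℕ => (t * r) ^ p.1 / p.1.factorial *
      (((p.2 + (p.1 + a)).choose (p.1 + a) : ℝ) * r ^ p.2))
      (fun p => by positivity) hrow hcol
  suffices hfun : (fun k => r ^ k * laguerreNeg a k t) = _ by
    rw [hfun]
    exact hall
  funext k
  rw [laguerreNeg, Finset.mul_sum, Finset.Nat.sum_antidiagonal_eq_sum_range_succ_mk]
  refine Finset.sum_congr rfl fun i hi => ?_
  have hik : i ≤ k := Nat.lt_succ_iff.1 (Finset.mem_range.1 hi)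
  have h1 : k - i + (i + a) = k + a := by omega
  have h2 : (k + a).choose (i + a) = (k + a).choose (k - i) := by
    rw [← Nat.choose_symm (by omega : k - i ≤ k + a)]
    congr 1
    omega
  simp only [h1, h2, mul_pow]
  rw [show r ^ k = r ^ i * r ^ (k - i) by rw [← pow_add, Nat.add_sub_cancel' hik]]
  ring

/-- Convergence on `[0, 1)` is absolute, so the difference series is analytic at `0`; its zeros
accumulate there, so it vanishes identically. -/
theorem eq_of_hasSum_pow_mul {a b : ℕ → ℝ} {S : ℝ → ℝ}
    (ha : ∀ r, 0 ≤ r → r < 1 → HasSum (fun k => r ^ k * a k) (S r))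
    (hb : ∀ r, 0 ≤ r → r < 1 → HasSum (fun k => r ^ k * b k) (S r)) : a = b := by
  let c : ℕ → ℝ := fun k => a k - b k
  have hc : ∀ r, 0 ≤ r → r < 1 → HasSum (fun k => r ^ k * c k) 0 := fun r h0 h1 => by
    simpa [c, mul_sub] using (ha r h0 h1).sub (hb r h0 h1)
  let f : ℝ → ℝ := fun r => ∑' k, r ^ k * c k
  have hf : HasFPowerSeriesAt f (FormalMultilinearSeries.ofScalars ℝ c) 0 := by
    rw [hasFPowerSeriesAt_iff]
    filter_upwards [Metric.ball_mem_nhds (0 : ℝ) one_pos] with r hr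
    have hr' : |r| < 1 := by simpa using hr
    have hs : Summable fun k => r ^ k * c k := by
      refine Summable.of_norm ?_
      simpa [abs_mul, abs_pow] using (hc |r| (abs_nonneg r) hr').summable.norm
    simpa [f] using hs.hasSum
  have hfreq : ∃ᶠ r in 𝓝[≠] (0 : ℝ), f r = 0 := by
    have h1 : ∀ᶠ r in 𝓝[>] (0 : ℝ), f r = 0 := by
      filter_upwards [Ioo_mem_nhdsGT (zero_lt_one' ℝ)] with r hr
      exact (hc r hr.1.le hr.2).tsum_eq
    exact h1.frequently.filter_mono (nhdsWithin_mono _ fun r hr => (ne_of_gt hr))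
  have hz := hf.analyticAt.frequently_zero_iff_eventually_zero.1 hfreq
  have hp := (hf.congr hz).eq_zero
  funext k
  have hk : FormalMultilinearSeries.ofScalars ℝ c k = 0 := by rw [hp]; rfl
  rw [FormalMultilinearSeries.ofScalars_eq_zero] at hk
  exact sub_eq_zero.1 hk

section
variable {E : Type*} [NormedAddCommGroup E] [InnerProductSpace ℝ E] [FiniteDimensional ℝ E]
  [MeasurableSpace E] [BorelSpace E]

theorem lintegral_comp_smul_addHaar (f : E → ℝ≥0∞) {c : ℝ} (hc : c ≠ 0) :
    ∫⁻ x, f (c • x) = ENNReal.ofReal |(c ^ Module.finrank ℝ E)⁻¹| * ∫⁻ x, f x := by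
  have h := (Homeomorph.smulOfNeZero (α := E) c hc).measurableEmbedding.lintegral_map (μ := volume) f
  simp only [Homeomorph.smulOfNeZero_apply] at h
  rw [← h]
  change ∫⁻ a, f a ∂(Measure.map (c • ·) volume) = _
  rw [Measure.map_addHaar_smul volume hc, lintegral_smul_measure]
  rfl

/-- The substitution is an isometry of `E × E`. Multiplied by the Jacobian of `√2 •`, both sides
become `∫∫ φ (v + √2 q) v` by Tonelli and one-variable substitutions. -/
theorem lintegral_lintegral_rotation {φ : E → E → ℝ≥0∞}
    (hφ : Measurable (Function.uncurry φ)) :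
    ∫⁻ u, ∫⁻ v, φ u v = ∫⁻ p, ∫⁻ q, φ ((√2)⁻¹ • (p + q)) ((√2)⁻¹ • (p - q)) := by
  have h2 : √2 ≠ 0 := by positivity
  have h22 : (√2)⁻¹ * 2 = √2 := by
    rw [inv_mul_eq_div, div_eq_iff h2, Real.mul_self_sqrt zero_le_two]
  have hm1 : Measurable (Function.uncurry
      fun p q : E => φ ((√2)⁻¹ • (p + q)) ((√2)⁻¹ • (p - q))) :=
    hφ.comp (Measurable.prodMk (by fun_prop) (by fun_prop))
  have hm2 : Measurable (Function.uncurry fun q v : E => φ (v + √2 • q) v) :=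
    hφ.comp (Measurable.prodMk (by fun_prop) (by fun_prop))
  have hc : ENNReal.ofReal |(√2 ^ Module.finrank ℝ E)⁻¹| ≠ 0 := by
    rw [Ne, ENNReal.ofReal_eq_zero, not_le]; positivity
  have key : ENNReal.ofReal |(√2 ^ Module.finrank ℝ E)⁻¹| * ∫⁻ u, ∫⁻ v, φ u v =
      ENNReal.ofReal |(√2 ^ Module.finrank ℝ E)⁻¹| *
        ∫⁻ p, ∫⁻ q, φ ((√2)⁻¹ • (p + q)) ((√2)⁻¹ • (p - q)) := by
    rw [lintegral_lintegral_swap hφ.aemeasurable, lintegral_lintegral_swap hm1.aemeasurable,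
      ← lintegral_const_mul' _ _ ENNReal.ofReal_ne_top,
      ← lintegral_const_mul' _ _ ENNReal.ofReal_ne_top]
    have hl : ∀ v : E, ENNReal.ofReal |(√2 ^ Module.finrank ℝ E)⁻¹| * ∫⁻ u, φ u v =
        ∫⁻ q, φ (v + √2 • q) v := fun v => by
      rw [lintegral_comp_smul_addHaar (fun q => φ (v + q) v) h2,
        lintegral_add_left_eq_self (fun u => φ u v)]
    have hr : ∀ q : E, ENNReal.ofReal |(√2 ^ Module.finrank ℝ E)⁻¹| *
        ∫⁻ p, φ ((√2)⁻¹ • (p + q)) ((√2)⁻¹ • (p - q)) = ∫⁻ v, φ (v + √2 • q) v := fun q => by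
      rw [← lintegral_add_right_eq_self (fun p => φ ((√2)⁻¹ • (p + q)) ((√2)⁻¹ • (p - q))) q,
        ← lintegral_comp_smul_addHaar
          (fun p => φ ((√2)⁻¹ • (p + q + q)) ((√2)⁻¹ • (p + q - q))) h2]
      refine lintegral_congr fun v => ?_
      congr 1
      · rw [add_assoc, ← two_smul ℝ q, smul_add, smul_smul, smul_smul, inv_mul_cancel₀ h2, h22,
          one_smul]
      · rw [add_sub_cancel_right, smul_smul, inv_mul_cancel₀ h2, one_smul]
    simp_rw [hl, hr]
    exact (lintegral_lintegral_swap hm2.aemeasurable).symm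
  exact (ENNReal.mul_right_inj hc ENNReal.ofReal_ne_top).1 key

theorem lintegral_exp_shifted_gaussian (y : E) {r : ℝ} (hr : r < 1) :
    ∫⁻ p : E, ENNReal.ofReal (Real.exp (r * ‖p‖ ^ 2 - ‖p - y‖ ^ 2)) =
      ENNReal.ofReal ((π / (1 - r)) ^ (Module.finrank ℝ E / 2 : ℝ) *
        Real.exp (‖y‖ ^ 2 * r / (1 - r))) := by
  have h1r : 0 < 1 - r := by linarith
  -- Completing the square moves the centre to `y / (1 - r)`.
  have hsq : ∀ p : E, Real.exp (r * ‖p‖ ^ 2 - ‖p - y‖ ^ 2) =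
      Real.exp (-(1 - r) * ‖p - (1 - r)⁻¹ • y‖ ^ 2) * Real.exp (‖y‖ ^ 2 * r / (1 - r)) := by
    intro p
    rw [← Real.exp_add]
    congr 1
    rw [@norm_sub_sq_real, @norm_sub_sq_real, norm_smul, inner_smul_right, Real.norm_of_nonneg
      (by positivity)]
    field_simp
    ring
  have hint : Integrable (fun p : E => Real.exp (-(1 - r) * ‖p‖ ^ 2)) := by
    refine Integrable.of_integral_ne_zero ?_
    rw [GaussianFourier.integral_rexp_neg_mul_sq_norm h1r]
    positivity
  simp_rw [hsq, ENNReal.ofReal_mul (Real.exp_nonneg _)]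
  rw [lintegral_mul_const' _ _ ENNReal.ofReal_ne_top,
    lintegral_sub_right_eq_self (fun p : E => ENNReal.ofReal (Real.exp (-(1 - r) * ‖p‖ ^ 2))),
    ← ofReal_integral_eq_lintegral_ofReal hint (ae_of_all _ fun _ => Real.exp_nonneg _),
    GaussianFourier.integral_rexp_neg_mul_sq_norm h1r, ← ENNReal.ofReal_mul (by positivity)]

end

end

/-! ### Gaussian moments and Laguerre polynomials. -/

section
open MeasureTheory Filter Topology Set
open scoped Real ENNReal

section
variable {E : Type*} [NormedAddCommGroup E] [InnerProductSpace ℝ E] [FiniteDimensional ℝ E]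
  [MeasurableSpace E] [BorelSpace E]

/-- The even absolute moments of a shifted Gaussian measure on `E × E`. -/
noncomputable def shiftedGaussianMoment (k : ℕ) (y : E) : ℝ≥0∞ :=
  ∫⁻ p : E, ∫⁻ q : E, ENNReal.ofReal
    ((‖p‖ ^ 2 + ‖q‖ ^ 2) ^ k * Real.exp (-‖p - y‖ ^ 2 - ‖q‖ ^ 2))

/-- Under the integral the sum is an exponential series, and the integrand splits into a Gaussian in
`p` and one in `q`. The two half-integer powers multiply to an integer one. -/
theorem tsum_shiftedGaussianMoment (y : E) {r : ℝ} (hr0 : 0 ≤ r) (hr1 : r < 1) :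
    ∑' k : ℕ, ENNReal.ofReal (r ^ k / k.factorial) * shiftedGaussianMoment k y =
      ENNReal.ofReal ((π / (1 - r)) ^ Module.finrank ℝ E *
        Real.exp (‖y‖ ^ 2 * r / (1 - r))) := by
  have h1r : 0 < 1 - r := by linarith
  have hcont : ∀ k : ℕ, Continuous fun x : E × E =>
      (‖x.1‖ ^ 2 + ‖x.2‖ ^ 2) ^ k * Real.exp (-‖x.1 - y‖ ^ 2 - ‖x.2‖ ^ 2) := fun k => by fun_prop
  have hmeas : ∀ k : ℕ, Measurable (Function.uncurry fun p q : E => ENNReal.ofReal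
      ((‖p‖ ^ 2 + ‖q‖ ^ 2) ^ k * Real.exp (-‖p - y‖ ^ 2 - ‖q‖ ^ 2))) := fun k =>
    (hcont k).measurable.ennreal_ofReal
  have hpt : ∀ p q : E, ∑' k : ℕ, ENNReal.ofReal (r ^ k / k.factorial) * ENNReal.ofReal
      ((‖p‖ ^ 2 + ‖q‖ ^ 2) ^ k * Real.exp (-‖p - y‖ ^ 2 - ‖q‖ ^ 2)) =
      ENNReal.ofReal (Real.exp (r * ‖p‖ ^ 2 - ‖p - y‖ ^ 2)) *
        ENNReal.ofReal (Real.exp (r * ‖q‖ ^ 2 - ‖q - 0‖ ^ 2)) := fun p q => by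
    have h : HasSum (fun k : ℕ => (r * (‖p‖ ^ 2 + ‖q‖ ^ 2)) ^ k / k.factorial)
        (Real.exp (r * (‖p‖ ^ 2 + ‖q‖ ^ 2))) := by
      rw [Real.exp_eq_exp_ℝ]
      exact NormedSpace.expSeries_div_hasSum_exp _
    have h' := h.mul_right (Real.exp (-‖p - y‖ ^ 2 - ‖q‖ ^ 2))
    rw [← ENNReal.ofReal_mul (Real.exp_nonneg _), ← Real.exp_add, sub_zero]
    rw [← Real.exp_add] at h'
    rw [show r * ‖p‖ ^ 2 - ‖p - y‖ ^ 2 + (r * ‖q‖ ^ 2 - ‖q‖ ^ 2) =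
      r * (‖p‖ ^ 2 + ‖q‖ ^ 2) + (-‖p - y‖ ^ 2 - ‖q‖ ^ 2) by ring, ← h'.tsum_eq,
      ENNReal.ofReal_tsum_of_nonneg (fun k => by positivity) h'.summable]
    refine tsum_congr fun k => ?_
    rw [← ENNReal.ofReal_mul (by positivity), mul_pow]
    congr 1
    ring
  unfold shiftedGaussianMoment
  simp_rw [← lintegral_const_mul' _ _ ENNReal.ofReal_ne_top]
  have hout : ∀ k : ℕ, Measurable fun p : E => ∫⁻ q : E,
      ENNReal.ofReal (r ^ k / k.factorial) * ENNReal.ofReal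
        ((‖p‖ ^ 2 + ‖q‖ ^ 2) ^ k * Real.exp (-‖p - y‖ ^ 2 - ‖q‖ ^ 2)) := fun k =>
    ((hmeas k).const_mul _).lintegral_prod_right'
  rw [← lintegral_tsum fun k => (hout k).aemeasurable]
  have hin : ∀ p : E, ∑' k : ℕ, ∫⁻ q : E, ENNReal.ofReal (r ^ k / k.factorial) * ENNReal.ofReal
      ((‖p‖ ^ 2 + ‖q‖ ^ 2) ^ k * Real.exp (-‖p - y‖ ^ 2 - ‖q‖ ^ 2)) =
      ENNReal.ofReal (Real.exp (r * ‖p‖ ^ 2 - ‖p - y‖ ^ 2)) *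
        ∫⁻ q : E, ENNReal.ofReal (Real.exp (r * ‖q‖ ^ 2 - ‖q - 0‖ ^ 2)) := fun p => by
    have hq : ∀ k : ℕ, Measurable fun q : E =>
        ENNReal.ofReal (r ^ k / k.factorial) * ENNReal.ofReal
          ((‖p‖ ^ 2 + ‖q‖ ^ 2) ^ k * Real.exp (-‖p - y‖ ^ 2 - ‖q‖ ^ 2)) := fun k =>
      ((hmeas k).of_uncurry_left (x := p)).const_mul _
    rw [← lintegral_tsum fun k => (hq k).aemeasurable,
      ← lintegral_const_mul' _ _ ENNReal.ofReal_ne_top]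
    exact lintegral_congr fun q => hpt p q
  simp_rw [hin]
  have hd : (π / (1 - r)) ^ (Module.finrank ℝ E / 2 : ℝ) *
      (π / (1 - r)) ^ (Module.finrank ℝ E / 2 : ℝ) = (π / (1 - r)) ^ Module.finrank ℝ E := by
    rw [← Real.rpow_add (by positivity), add_halves, Real.rpow_natCast]
  rw [lintegral_exp_shifted_gaussian 0 hr1, lintegral_mul_const' _ _ ENNReal.ofReal_ne_top,
    lintegral_exp_shifted_gaussian y hr1, ← ENNReal.ofReal_mul (by positivity), ← hd]
  congr 1
  simp only [norm_zero, ne_eq, OfNat.ofNat_ne_zero, not_false_eq_true, zero_pow, zero_mul,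
    zero_div, Real.exp_zero]
  ring

/-- Both sides, divided by `k!`, have the same generating function. The type is `dim E - 1` because
the moments live on `E × E`. -/
theorem shiftedGaussianMoment_eq {a : ℕ} (ha : Module.finrank ℝ E = a + 1) (k : ℕ) (y : E) :
    shiftedGaussianMoment k y =
      ENNReal.ofReal (π ^ (a + 1) * k.factorial * laguerreNeg a k (‖y‖ ^ 2)) := by
  -- One infinite moment would make the generating function infinite at `r = 1/2`.
  have hfin : ∀ k, shiftedGaussianMoment k y ≠ ⊤ := fun k hk => by
    have h := ENNReal.le_tsum (f := fun k : ℕ =>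
      ENNReal.ofReal ((1 / 2 : ℝ) ^ k / k.factorial) * shiftedGaussianMoment k y) k
    rw [tsum_shiftedGaussianMoment y (by norm_num) (by norm_num), hk, ENNReal.mul_top
      (by rw [Ne, ENNReal.ofReal_eq_zero, not_le]; positivity), top_le_iff] at h
    exact ENNReal.ofReal_ne_top h
  have key : (fun k : ℕ => (shiftedGaussianMoment k y).toReal / k.factorial) =
      fun k => π ^ (a + 1) * laguerreNeg a k (‖y‖ ^ 2) := by
    refine eq_of_hasSum_pow_mul (S := fun r => (π / (1 - r)) ^ (a + 1) *
      Real.exp (‖y‖ ^ 2 * r / (1 - r))) (fun r h0 h1 => ?_) fun r h0 h1 => ?_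
    · have h := tsum_shiftedGaussianMoment y h0 h1
      have h1r : 0 < 1 - r := by linarith
      have hs := ENNReal.hasSum_toReal (h ▸ ENNReal.ofReal_ne_top)
      rw [← ENNReal.tsum_toReal_eq fun k => ENNReal.mul_ne_top ENNReal.ofReal_ne_top (hfin k), h,
        ENNReal.toReal_ofReal (by positivity), ha] at hs
      suffices hf : (fun k => r ^ k * ((shiftedGaussianMoment k y).toReal / k.factorial)) = _ by
        rw [hf]; exact hs
      funext k
      rw [ENNReal.toReal_mul, ENNReal.toReal_ofReal (by positivity)]
      ring
    · have h := (hasSum_laguerreNeg a (sq_nonneg ‖y‖) h0 h1).mul_left (π ^ (a + 1))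
      suffices hf : (fun k => r ^ k * (π ^ (a + 1) * laguerreNeg a k (‖y‖ ^ 2))) = _ by
        rw [hf, div_pow, div_eq_mul_one_div, mul_assoc]; exact h
      funext k
      ring
  have hk := congrFun key k
  rw [div_eq_iff (by positivity)] at hk
  rw [← ENNReal.ofReal_toReal (hfin k), hk]
  ring_nf

/-- The absolute moments of a real Gaussian measure are bounded by the square roots of the Laguerre
polynomials. -/
theorem sq_lintegral_norm_pow_mul_gaussian_le {a : ℕ} (ha : Module.finrank ℝ E = a + 1) (k : ℕ)
    (x : E) :
    (∫⁻ u : E, ENNReal.ofReal ((√2 * ‖u‖) ^ k * Real.exp (-‖x - u‖ ^ 2))) ^ 2 ≤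
      ENNReal.ofReal (π ^ (a + 1) * k.factorial * laguerreNeg a k (2 * ‖x‖ ^ 2)) := by
  have h2 : √2 * √2 = 2 := Real.mul_self_sqrt zero_le_two
  have h2i : (√2)⁻¹ * (√2)⁻¹ = 1 / 2 := by rw [← mul_inv, h2, one_div]
  have hy : 2 * ‖x‖ ^ 2 = ‖√2 • x‖ ^ 2 := by
    rw [norm_smul, mul_pow, Real.norm_of_nonneg (Real.sqrt_nonneg 2), sq √2, h2]
  rw [hy, ← shiftedGaussianMoment_eq ha, sq,
    ← lintegral_mul_const _ (Continuous.measurable (by fun_prop)).ennreal_ofReal]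
  have hφ : Measurable (Function.uncurry fun u v : E =>
      ENNReal.ofReal ((√2 * ‖u‖) ^ k * Real.exp (-‖x - u‖ ^ 2)) *
        ENNReal.ofReal ((√2 * ‖v‖) ^ k * Real.exp (-‖x - v‖ ^ 2))) :=
    (Continuous.measurable (by fun_prop)).ennreal_ofReal.mul
      (Continuous.measurable (by fun_prop)).ennreal_ofReal
  simp_rw [← lintegral_const_mul' _ _ ENNReal.ofReal_ne_top]
  rw [lintegral_lintegral_rotation hφ, shiftedGaussianMoment]
  refine lintegral_mono fun p => lintegral_mono fun q => ?_
  simp only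
  rw [← ENNReal.ofReal_mul (by positivity)]
  refine ENNReal.ofReal_le_ofReal ?_
  set u := (√2)⁻¹ • (p + q) with hu
  set v := (√2)⁻¹ • (p - q) with hv
  have hsum : ‖u‖ ^ 2 + ‖v‖ ^ 2 = ‖p‖ ^ 2 + ‖q‖ ^ 2 := by
    rw [hu, hv, norm_smul, norm_smul, mul_pow, mul_pow, norm_add_sq_real, norm_sub_sq_real,
      Real.norm_of_nonneg (by positivity), sq (√2)⁻¹, h2i]
    ring
  -- The rotation carries the centre `(x, x)` to `(√2 x, 0)`, which produces the argument `2|x|²`.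
  have hexp : ‖x - u‖ ^ 2 + ‖x - v‖ ^ 2 = ‖p - √2 • x‖ ^ 2 + ‖q‖ ^ 2 := by
    have huv : inner ℝ x u + inner ℝ x v = √2 * inner ℝ p x := by
      rw [← inner_add_right, hu, hv, ← smul_add, add_add_sub_cancel, ← two_smul ℝ p, smul_smul,
        inner_smul_right, real_inner_comm, inv_mul_eq_div]
      congr 1
      rw [div_eq_iff (by positivity), h2]
    rw [norm_sub_sq_real x, norm_sub_sq_real x, norm_sub_sq_real p, inner_smul_right p, ← hy]
    linarith
  calc (√2 * ‖u‖) ^ k * Real.exp (-‖x - u‖ ^ 2) * ((√2 * ‖v‖) ^ k * Real.exp (-‖x - v‖ ^ 2))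
      = (2 * ‖u‖ * ‖v‖) ^ k * Real.exp (-(‖x - u‖ ^ 2 + ‖x - v‖ ^ 2)) := by
        rw [neg_add, Real.exp_add,
          show 2 * ‖u‖ * ‖v‖ = (√2 * ‖u‖) * (√2 * ‖v‖) by linear_combination -(‖u‖ * ‖v‖) * h2,
          mul_pow]
        ring
    _ ≤ (‖p‖ ^ 2 + ‖q‖ ^ 2) ^ k * Real.exp (-(‖x - u‖ ^ 2 + ‖x - v‖ ^ 2)) := by
        gcongr
        rw [← hsum]
        exact two_mul_le_add_sq _ _
    _ = _ := by rw [hexp, neg_add, ← sub_eq_add_neg]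

end

end

/-! ### Polynomial multiples of the Gaussian and Hermite polynomials. -/

section
open MeasureTheory Filter Topology
open scoped Real ENNReal SchwartzMap LineDeriv Laplacian

theorem one_add_pow_mul_exp_neg_sq_le (M : ℕ) {t : ℝ} (ht : 0 ≤ t) :
    (1 + t) ^ M * Real.exp (-t ^ 2 / 2) ≤ M.factorial * Real.exp (3 / 2) := by
  have h1 : (1 + t) ^ M ≤ M.factorial * Real.exp (1 + t) := by
    have := Real.pow_div_factorial_le_exp (1 + t) (by linarith) M
    rwa [div_le_iff₀' (by positivity)] at this
  calc (1 + t) ^ M * Real.exp (-t ^ 2 / 2)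
      ≤ M.factorial * Real.exp (1 + t) * Real.exp (-t ^ 2 / 2) := by gcongr
    _ = M.factorial * Real.exp (1 + t + -t ^ 2 / 2) := by rw [mul_assoc, ← Real.exp_add]
    _ ≤ _ := by
      gcongr
      nlinarith [sq_nonneg (t - 1)]

section
variable {E : Type*} [NormedAddCommGroup E] [InnerProductSpace ℝ E]

/-- The Gaussian `exp (-|x|² / 2)` as a Schwartz function. -/
noncomputable def gaussianSchwartz (E : Type*) [NormedAddCommGroup E] [InnerProductSpace ℝ E] :
    𝓢(E, ℂ) where
  toFun x := ((Real.exp (-‖x‖ ^ 2 / 2) : ℝ) : ℂ)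
  smooth' := by
    refine Complex.ofRealCLM.contDiff.comp (Real.contDiff_exp.comp ?_)
    exact ((contDiff_norm_sq ℝ).neg).div_const 2
  decay' k n := by
    have hT : (fun x : E => -‖x‖ ^ 2 / 2).HasTemperateGrowth := by
      have : (fun x : E => -‖x‖ ^ 2 / 2) = fun x => (-1 / 2 : ℝ) * ‖x‖ ^ 2 := by
        funext x; ring
      rw [this]
      fun_prop
    obtain ⟨l, C, hC, hb⟩ := hT.norm_iteratedFDeriv_le_uniform n
    refine ⟨(n.factorial * (1 + C) ^ n) * ((k + l * n).factorial * Real.exp (3 / 2)),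
      fun x => ?_⟩
    have hcomp : (fun x : E => ((Real.exp (-‖x‖ ^ 2 / 2) : ℝ) : ℂ)) =
        Complex.ofRealLI ∘ (Real.exp ∘ fun x : E => -‖x‖ ^ 2 / 2) := rfl
    have hcd : ContDiff ℝ n (fun x : E => -‖x‖ ^ 2 / 2) :=
      ((contDiff_norm_sq ℝ).neg).div_const 2
    rw [hcomp, LinearIsometry.norm_iteratedFDeriv_comp_left _
      (Real.contDiff_exp.comp hcd).contDiffAt le_rfl]
    have hx : 0 ≤ ‖x‖ := norm_nonneg x
    -- Every derivative of `exp` is `exp`, and those of `-|x|²/2` grow polynomially; since `D ≥ 1`,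
    -- the bound `D` also serves as `D ^ i`.
    have key := norm_iteratedFDeriv_comp_le (n := n) (N := n) Real.contDiff_exp hcd le_rfl x
      (C := Real.exp (-‖x‖ ^ 2 / 2)) (D := (1 + C) * (1 + ‖x‖) ^ l) (fun i _ => by
        rw [norm_iteratedFDeriv_eq_norm_iteratedDeriv, iteratedDeriv_eq_iterate, Real.iter_deriv_exp,
          Real.norm_of_nonneg (Real.exp_nonneg _)]) (fun i hi1 hin => by
        have h1 : 1 ≤ (1 + C) * (1 + ‖x‖) ^ l :=
          one_le_mul_of_one_le_of_one_le (by linarith) (one_le_pow₀ (by linarith))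
        refine (hb i hin x).trans (le_trans ?_ (le_self_pow₀ h1 (by omega)))
        gcongr
        linarith)
    calc ‖x‖ ^ k * ‖iteratedFDeriv ℝ n (Real.exp ∘ fun x : E => -‖x‖ ^ 2 / 2) x‖
        ≤ (1 + ‖x‖) ^ k * (n.factorial * Real.exp (-‖x‖ ^ 2 / 2) *
            ((1 + C) * (1 + ‖x‖) ^ l) ^ n) := by
          gcongr
          linarith
      _ = n.factorial * (1 + C) ^ n * ((1 + ‖x‖) ^ (k + l * n) * Real.exp (-‖x‖ ^ 2 / 2)) := by
          rw [mul_pow, pow_add, pow_mul]; ring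
      _ ≤ _ := by
          refine mul_le_mul_of_nonneg_left ?_ (by positivity)
          exact one_add_pow_mul_exp_neg_sq_le _ hx

theorem gaussianSchwartz_apply (x : E) :
    gaussianSchwartz E x = ((Real.exp (-‖x‖ ^ 2 / 2) : ℝ) : ℂ) := rfl

theorem Polynomial.hasTemperateGrowth_eval_inner (P : Polynomial ℝ) (ω : E) :
    (fun x : E => ((P.eval (inner ℝ ω x) : ℝ) : ℂ)).HasTemperateGrowth := by
  have h : (fun x : E => P.eval (inner ℝ ω x)).HasTemperateGrowth := by
    simp_rw [Polynomial.eval_eq_sum_range]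
    refine Function.HasTemperateGrowth.sum fun i _ => ?_
    exact (Function.HasTemperateGrowth.const _).mul
      ((Function.hasTemperateGrowth_inner_right ω).pow i)
  fun_prop

/-- The Schwartz function `P(ω · x) exp (-|x|² / 2)`. -/
noncomputable def polyGaussian (ω : E) (P : Polynomial ℝ) : 𝓢(E, ℂ) :=
  SchwartzMap.smulLeftCLM ℂ (fun x : E => ((P.eval (inner ℝ ω x) : ℝ) : ℂ)) (gaussianSchwartz E)

theorem polyGaussian_apply (ω : E) (P : Polynomial ℝ) (x : E) :
    polyGaussian ω P x = ((P.eval (inner ℝ ω x) * Real.exp (-‖x‖ ^ 2 / 2) : ℝ) : ℂ) := by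
  rw [polyGaussian, SchwartzMap.smulLeftCLM_apply_apply (P.hasTemperateGrowth_eval_inner ω),
    gaussianSchwartz_apply, smul_eq_mul, Complex.ofReal_mul]

theorem hasDerivAt_gaussian_line (x v : E) :
    HasDerivAt (fun t : ℝ => Real.exp (-‖x + t • v‖ ^ 2 / 2))
      (-inner ℝ v x * Real.exp (-‖x‖ ^ 2 / 2)) 0 := by
  have h0 : HasDerivAt (fun t : ℝ => x + t • v) v 0 := by
    simpa using ((hasDerivAt_id (0 : ℝ)).smul_const v).const_add x
  have h1 := ((h0.norm_sq.neg).div_const 2).exp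
  simp only [Pi.neg_apply, zero_smul, add_zero] at h1
  refine h1.congr_deriv ?_
  rw [real_inner_comm]
  ring

theorem hasDerivAt_inner_line (w x v : E) :
    HasDerivAt (fun t : ℝ => inner ℝ w (x + t • v)) (inner ℝ w v) 0 := by
  have h : (fun t : ℝ => inner ℝ w (x + t • v)) = fun t => inner ℝ w x + t * inner ℝ w v := by
    funext t; rw [inner_add_right, inner_smul_right]
  rw [h]
  simpa using ((hasDerivAt_id (0 : ℝ)).mul_const (inner ℝ w v)).const_add (inner ℝ w x)

theorem hasDerivAt_eval_line (P : Polynomial ℝ) (ω x v : E) :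
    HasDerivAt (fun t : ℝ => P.eval (inner ℝ ω (x + t • v)))
      (inner ℝ ω v * P.derivative.eval (inner ℝ ω x)) 0 := by
  have h := (P.hasDerivAt (inner ℝ ω (x + (0 : ℝ) • v))).comp (0 : ℝ) (hasDerivAt_inner_line ω x v)
  simp only [zero_smul, add_zero] at h
  exact h.congr_deriv (mul_comm _ _)

theorem lineDeriv_polyGaussian (ω : E) (P : Polynomial ℝ) (v x : E) :
    (∂_{v} (polyGaussian ω P)) x =
      (((inner ℝ ω v * P.derivative.eval (inner ℝ ω x) - inner ℝ v x * P.eval (inner ℝ ω x)) *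
        Real.exp (-‖x‖ ^ 2 / 2) : ℝ) : ℂ) := by
  rw [SchwartzMap.lineDerivOp_apply]
  refine HasLineDerivAt.lineDeriv ?_
  have h := ((hasDerivAt_eval_line P ω x v).mul (hasDerivAt_gaussian_line x v)).ofReal_comp
  simp only [zero_smul, add_zero] at h
  unfold HasLineDerivAt
  simp only [polyGaussian_apply]
  refine h.congr_deriv ?_
  congr 1
  ring

theorem lineDeriv_lineDeriv_polyGaussian (ω : E) (P : Polynomial ℝ) (v x : E) :
    (∂_{v} (∂_{v} (polyGaussian ω P))) x =
      (((inner ℝ ω v ^ 2 * P.derivative.derivative.eval (inner ℝ ω x) -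
        ‖v‖ ^ 2 * P.eval (inner ℝ ω x) -
        2 * (inner ℝ ω v * inner ℝ v x) * P.derivative.eval (inner ℝ ω x) +
        inner ℝ v x ^ 2 * P.eval (inner ℝ ω x)) * Real.exp (-‖x‖ ^ 2 / 2) : ℝ) : ℂ) := by
  rw [SchwartzMap.lineDerivOp_apply]
  refine HasLineDerivAt.lineDeriv ?_
  have h := ((((hasDerivAt_eval_line P.derivative ω x v).const_mul (inner ℝ ω v)).sub
    ((hasDerivAt_inner_line v x v).mul (hasDerivAt_eval_line P ω x v))).mul
      (hasDerivAt_gaussian_line x v)).ofReal_comp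
  simp only [zero_smul, add_zero, Pi.mul_apply, Pi.sub_apply] at h
  unfold HasLineDerivAt
  simp only [lineDeriv_polyGaussian]
  refine h.congr_deriv ?_
  congr 1
  rw [real_inner_self_eq_norm_sq]
  ring

variable [FiniteDimensional ℝ E]

/-- Sum the second derivatives over an orthonormal basis and use Parseval. For `P` a Hermite
polynomial the differential equation turns this into the eigenvalue relation. -/
theorem laplacian_polyGaussian {ω : E} (hω : ‖ω‖ = 1) (P : Polynomial ℝ) (x : E) :
    (Δ (polyGaussian ω P)) x =
      (((P.derivative.derivative.eval (inner ℝ ω x) -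
        2 * inner ℝ ω x * P.derivative.eval (inner ℝ ω x) -
        Module.finrank ℝ E * P.eval (inner ℝ ω x) + ‖x‖ ^ 2 * P.eval (inner ℝ ω x)) *
          Real.exp (-‖x‖ ^ 2 / 2) : ℝ) : ℂ) := by
  let b := stdOrthonormalBasis ℝ E
  rw [SchwartzMap.laplacian_eq_sum b, sum_apply]
  simp only [lineDeriv_lineDeriv_polyGaussian]
  rw [← Complex.ofReal_sum, ← Finset.sum_mul]
  congr 2
  rw [Finset.sum_add_distrib, Finset.sum_sub_distrib, Finset.sum_sub_distrib, ← Finset.sum_mul,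
    ← Finset.sum_mul, ← Finset.sum_mul, ← Finset.sum_mul, ← Finset.mul_sum]
  have h1 : ∑ i, inner ℝ ω (b i) ^ 2 = 1 := by
    have := b.sum_sq_inner_left ω
    rw [this, hω, one_pow]
  have h2 : ∑ i, inner ℝ (b i) x ^ 2 = ‖x‖ ^ 2 := b.sum_sq_inner_right x
  have h3 : ∑ i, inner ℝ ω (b i) * inner ℝ (b i) x = inner ℝ ω x := b.sum_inner_mul_inner ω x
  have h4 : ∑ i, ‖b i‖ ^ 2 = (Module.finrank ℝ E : ℝ) := by simp
  rw [h1, h2, h3, h4]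
  ring

end

/-- The physicists' Hermite polynomials. -/
noncomputable def physHermite : ℕ → Polynomial ℝ
  | 0 => 1
  | k + 1 => Polynomial.C 2 * Polynomial.X * physHermite k - (physHermite k).derivative

theorem derivative_physHermite_succ (k : ℕ) :
    (physHermite (k + 1)).derivative = Polynomial.C (2 * (k + 1) : ℝ) * physHermite k := by
  induction k with
  | zero => simp [physHermite]
  | succ k ih =>
    rw [physHermite, Polynomial.derivative_sub, ih]
    simp only [Polynomial.derivative_mul, Polynomial.derivative_C, Polynomial.derivative_X, ih]
    rw [show physHermite (k + 1) = Polynomial.C 2 * Polynomial.X * physHermite k -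
      (physHermite k).derivative from rfl]
    simp only [Nat.cast_add, Nat.cast_one, Polynomial.C_mul, Polynomial.C_add, Polynomial.C_1,
      map_natCast]
    ring

/-- The Hermite differential equation. -/
theorem physHermite_ode (k : ℕ) (s : ℝ) :
    (physHermite k).derivative.derivative.eval s =
      2 * s * (physHermite k).derivative.eval s - 2 * k * (physHermite k).eval s := by
  cases k with
  | zero => simp [physHermite]
  | succ k =>
    have h : physHermite (k + 1) = Polynomial.C 2 * Polynomial.X * physHermite k -
      (physHermite k).derivative := rfl
    simp only [derivative_physHermite_succ, Polynomial.derivative_mul, Polynomial.derivative_C]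
    rw [h]
    simp only [Polynomial.eval_mul, Polynomial.eval_add, Polynomial.eval_sub, Polynomial.eval_C,
      Polynomial.eval_X, zero_mul, Polynomial.eval_zero, Nat.cast_add, Nat.cast_one]
    ring

end

/-! ### Hermite functions in one direction and the projections `P_k`. -/

section
open MeasureTheory Filter Topology
open scoped Real ENNReal SchwartzMap LineDeriv Laplacian

/-- The iterated derivatives of the generating function of the Hermite polynomials. -/
theorem iteratedDeriv_hermite_generating (s : ℝ) (k : ℕ) :
    iteratedDeriv k (fun τ : ℂ => Complex.exp (2 * s * τ - τ ^ 2)) = fun τ =>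
      ((physHermite k).map Complex.ofRealHom).eval ((s : ℂ) - τ) * Complex.exp (2 * s * τ - τ ^ 2) := by
  induction k with
  | zero => simp [physHermite]
  | succ k ih =>
    rw [iteratedDeriv_succ, ih]
    funext τ
    have h1 : HasDerivAt (fun τ : ℂ => (s : ℂ) - τ) (-1) τ := by
      simpa using (hasDerivAt_id τ).const_sub (s : ℂ)
    have h2 : HasDerivAt (fun τ : ℂ => Complex.exp (2 * s * τ - τ ^ 2))
        (Complex.exp (2 * s * τ - τ ^ 2) * (2 * s - 2 * τ)) τ := by
      have := (((hasDerivAt_id τ).const_mul (2 * (s : ℂ))).sub ((hasDerivAt_id τ).pow 2)).cexp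
      simpa using this
    have h3 := ((((physHermite k).map Complex.ofRealHom).hasDerivAt (s - τ)).comp τ h1).mul h2
    refine h3.deriv.trans ?_
    rw [physHermite, Polynomial.derivative_map]
    simp only [Polynomial.map_sub, Polynomial.map_mul, Polynomial.map_C, Polynomial.map_X,
      Polynomial.eval_sub, Polynomial.eval_mul, Polynomial.eval_C, Polynomial.eval_X,
      Function.comp_apply]
    have : Complex.ofRealHom 2 = 2 := by simp
    rw [this]
    ring

/-- The generating function of the Hermite polynomials. -/
theorem hasSum_physHermite (s : ℝ) (τ : ℂ) :
    HasSum (fun k : ℕ => τ ^ k / k.factorial * ((physHermite k).eval s : ℝ))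
      (Complex.exp (2 * s * τ - τ ^ 2)) := by
  have hd : Differentiable ℂ fun τ : ℂ => Complex.exp (2 * s * τ - τ ^ 2) := by fun_prop
  have h := Complex.hasSum_taylorSeries_of_entire hd 0 τ
  suffices hf : (fun k : ℕ => τ ^ k / k.factorial * (((physHermite k).eval s : ℝ) : ℂ)) = _ by
    rw [hf]; exact h
  funext k
  have he : ((physHermite k).map Complex.ofRealHom).eval (s : ℂ) =
      (((physHermite k).eval s : ℝ) : ℂ) := Polynomial.eval_map_apply Complex.ofRealHom s
  rw [iteratedDeriv_hermite_generating]
  simp only [sub_zero, mul_zero, smul_eq_mul, ne_eq, OfNat.ofNat_ne_zero, not_false_eq_true,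
    zero_pow, Complex.exp_zero, mul_one, he]
  ring

section
variable {E : Type*} [NormedAddCommGroup E] [InnerProductSpace ℝ E]

/-- The Hermite function of degree `k` in the direction `ω`. -/
noncomputable def hermiteSlice (ω : E) (k : ℕ) : 𝓢(E, ℂ) := polyGaussian ω (physHermite k)

theorem hermiteSlice_apply (ω : E) (k : ℕ) (x : E) : hermiteSlice ω k x =
    (((physHermite k).eval (inner ℝ ω x) * Real.exp (-‖x‖ ^ 2 / 2) : ℝ) : ℂ) :=
  polyGaussian_apply ω _ x

theorem hermiteSlice_succ_apply (ω : E) (hω : ‖ω‖ = 1) (k : ℕ) (x : E) :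
    hermiteSlice ω (k + 1) x = inner ℝ ω x * hermiteSlice ω k x - (∂_{ω} (hermiteSlice ω k)) x := by
  rw [hermiteSlice_apply, hermiteSlice_apply, hermiteSlice, lineDeriv_polyGaussian,
    ← Complex.ofReal_mul, ← Complex.ofReal_sub, real_inner_self_eq_norm_sq, hω, physHermite]
  congr 1
  simp only [Polynomial.eval_sub, Polynomial.eval_mul, Polynomial.eval_C, Polynomial.eval_X]
  ring

theorem inner_mul_hermiteSlice_add_lineDeriv (ω : E) (hω : ‖ω‖ = 1) (k : ℕ) (x : E) :
    inner ℝ ω x * hermiteSlice ω (k + 1) x + (∂_{ω} (hermiteSlice ω (k + 1))) x =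
      (2 * (k + 1) : ℝ) * hermiteSlice ω k x := by
  rw [hermiteSlice_apply, hermiteSlice_apply, hermiteSlice, lineDeriv_polyGaussian,
    ← Complex.ofReal_mul, ← Complex.ofReal_add, ← Complex.ofReal_mul, real_inner_self_eq_norm_sq,
    hω, derivative_physHermite_succ]
  congr 1
  simp only [Polynomial.eval_mul, Polynomial.eval_C]
  ring

variable [FiniteDimensional ℝ E] [MeasurableSpace E] [BorelSpace E]

/-- Ladder argument: integration by parts moves the raising operator `ω · x - ∂_ω` to the other
factor as the lowering operator, which contributes `2(k + 1)`. -/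
theorem integral_hermiteSlice_sq (ω : E) (hω : ‖ω‖ = 1) (k : ℕ) :
    ∫ x : E, hermiteSlice ω k x * hermiteSlice ω k x =
      ((π ^ (Module.finrank ℝ E / 2 : ℝ) * (2 ^ k * k.factorial) : ℝ) : ℂ) := by
  induction k with
  | zero =>
    have h : ∀ x : E, hermiteSlice ω 0 x * hermiteSlice ω 0 x =
        ((Real.exp (-1 * ‖x‖ ^ 2) : ℝ) : ℂ) := fun x => by
      rw [hermiteSlice_apply, ← Complex.ofReal_mul]
      simp only [physHermite, Polynomial.eval_one, one_mul]
      rw [← Real.exp_add]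
      congr 2
      ring
    simp_rw [h]
    rw [integral_complex_ofReal, GaussianFourier.integral_rexp_neg_mul_sq_norm one_pos]
    simp
  | succ k ih =>
    let s : 𝓢(E, ℂ) → 𝓢(E, ℂ) := fun f =>
      SchwartzMap.smulLeftCLM ℂ (fun x : E => ((inner ℝ ω x : ℝ) : ℂ)) f
    have hs : ∀ f x, s f x = inner ℝ ω x * f x := fun f x => by
      simp only [s]
      rw [SchwartzMap.smulLeftCLM_apply_apply (by fun_prop), smul_eq_mul]
    have hint : ∀ f g : 𝓢(E, ℂ), Integrable fun x => f x * g x := fun f g =>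
      (SchwartzMap.pairing (ContinuousLinearMap.mul ℝ ℂ) f g).integrable
    calc ∫ x : E, hermiteSlice ω (k + 1) x * hermiteSlice ω (k + 1) x
        = ∫ x : E, (s (hermiteSlice ω k) x * hermiteSlice ω (k + 1) x -
            (∂_{ω} (hermiteSlice ω k)) x * hermiteSlice ω (k + 1) x) := by
          refine integral_congr_ae (ae_of_all _ fun x => ?_)
          simp only
          rw [← sub_mul, hs, ← hermiteSlice_succ_apply ω hω]
      _ = ∫ x : E, (s (hermiteSlice ω k) x * hermiteSlice ω (k + 1) x +
            hermiteSlice ω k x * (∂_{ω} (hermiteSlice ω (k + 1))) x) := by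
          rw [integral_sub (hint _ _) (hint _ _), integral_add (hint _ _) (hint _ _),
            SchwartzMap.integral_mul_lineDerivOp_right_eq_neg_left, sub_eq_add_neg]
      _ = ∫ x : E, ((2 * (k + 1) : ℝ) : ℂ) * (hermiteSlice ω k x * hermiteSlice ω k x) := by
          refine integral_congr_ae (ae_of_all _ fun x => ?_)
          have h := inner_mul_hermiteSlice_add_lineDeriv ω hω k x
          simp only [hs]
          linear_combination hermiteSlice ω k x * h
      _ = _ := by
          rw [integral_const_mul, ih, ← Complex.ofReal_mul, Nat.factorial_succ]
          congr 1
          push_cast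
          ring

theorem norm_hermiteSlice_toLp_sq (ω : E) (hω : ‖ω‖ = 1) (k : ℕ) :
    ‖(hermiteSlice ω k).toLp 2 (volume : Measure E)‖ ^ 2 =
      π ^ (Module.finrank ℝ E / 2 : ℝ) * (2 ^ k * k.factorial) := by
  have h := inner_self_eq_norm_sq_to_K (𝕜 := ℂ) ((hermiteSlice ω k).toLp 2 (volume : Measure E))
  rw [SchwartzMap.inner_toL2_toL2_eq _ _ volume] at h
  have h2 : ∫ x : E, inner ℂ (hermiteSlice ω k x) (hermiteSlice ω k x) =
      ∫ x : E, hermiteSlice ω k x * hermiteSlice ω k x := by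
    refine integral_congr_ae (ae_of_all _ fun x => ?_)
    simp only [hermiteSlice_apply, RCLike.inner_apply, Complex.conj_ofReal]
  rw [h2, integral_hermiteSlice_sq ω hω] at h
  apply Complex.ofReal_injective
  rw [Complex.ofReal_pow]
  exact h.symm

end

/-- Symmetry of the Laplacian moves it from the test function to the Hermite function, where the
Hermite equation applies pointwise. -/
theorem hermiteSlice_mem_eigenspace {n : ℕ} {ω : RSpace n} (hω : ‖ω‖ = 1) (k : ℕ) :
    (hermiteSlice ω k).toLp 2 (volume : Measure (RSpace n)) ∈ hermiteEigenspace n k := by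
  rw [mem_hermiteEigenspace_iff]
  ext ψ
  have hg : (fun x : RSpace n => ((‖x‖ ^ 2 : ℝ) : ℂ)).HasTemperateGrowth := by fun_prop
  let q : 𝓢(RSpace n, ℂ) := SchwartzMap.smulLeftCLM ℂ (fun x : RSpace n => ((‖x‖ ^ 2 : ℝ) : ℂ)) ψ
  have hq : ∀ x, q x = ((‖x‖ ^ 2 : ℝ) : ℂ) * ψ x := fun x => by
    simp only [q]
    rw [SchwartzMap.smulLeftCLM_apply_apply hg, smul_eq_mul]
  have hint : ∀ f g : 𝓢(RSpace n, ℂ), Integrable fun x => f x * g x := fun f g =>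
    (SchwartzMap.pairing (ContinuousLinearMap.mul ℝ ℂ) f g).integrable
  rw [hermiteOperator_apply n _ ψ (-Δ ψ + q) fun x => by
    rw [add_apply, neg_apply, hq]]
  rw [Lp.toTemperedDistribution_toLp_eq, smul_apply,
    SchwartzMap.toTemperedDistributionCLM_apply_apply volume,
    SchwartzMap.toTemperedDistributionCLM_apply_apply volume, smul_eq_mul, ← integral_const_mul]
  set K := hermiteSlice ω k with hK
  calc ∫ x, (-Δ ψ + q) x • K x = ∫ x, (K x * q x - K x * (Δ ψ) x) := by
        refine integral_congr_ae (ae_of_all _ fun x => ?_)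
        simp only [add_apply, neg_apply, smul_eq_mul]
        ring
    _ = ∫ x, (K x * q x - (Δ K) x * ψ x) := by
        rw [integral_sub (hint _ _) (hint _ _), integral_sub (hint _ _) (hint _ _),
          SchwartzMap.integral_mul_laplacian_right_eq_left]
    _ = _ := by
        refine integral_congr_ae (ae_of_all _ fun x => ?_)
        have h1 : (Δ K) x = ((‖x‖ ^ 2 : ℝ) : ℂ) * K x - (2 * k + n : ℂ) * K x := by
          rw [hK, hermiteSlice_apply, hermiteSlice, laplacian_polyGaussian hω, physHermite_ode,
            finrank_euclideanSpace, Fintype.card_fin]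
          push_cast
          ring
        simp only [hq, h1, smul_eq_mul]
        ring

/-- Pairing with an element of the eigenspace does not distinguish `f` from `P_k f`; then
Cauchy–Schwarz. -/
theorem norm_integral_mul_hermiteSlice_le {n : ℕ} (f : L2Space n) {ω : RSpace n} (hω : ‖ω‖ = 1)
    (k : ℕ) : ‖∫ x, f x * hermiteSlice ω k x‖ ≤
      ‖hermiteProj n k f‖ * √(π ^ (n / 2 : ℝ) * (2 ^ k * k.factorial)) := by
  set K := (hermiteSlice ω k).toLp 2 (volume : Measure (RSpace n)) with hK
  have h1 : ∫ x, f x * hermiteSlice ω k x = inner ℂ K f := by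
    rw [L2.inner_def]
    refine integral_congr_ae ?_
    filter_upwards [(hermiteSlice ω k).coeFn_toLp 2 (volume : Measure (RSpace n))] with x hx
    rw [hK, hx, RCLike.inner_apply, hermiteSlice_apply, Complex.conj_ofReal]
  have h2 : inner ℂ K f = inner ℂ K (hermiteProj n k f) := by
    rw [hermiteProj, ← Submodule.inner_starProjection_left_eq_right,
      Submodule.starProjection_eq_self_iff.2 (hermiteSlice_mem_eigenspace hω k)]
  have h3 : ‖K‖ = √(π ^ (n / 2 : ℝ) * (2 ^ k * k.factorial)) := by
    rw [← Real.sqrt_sq (norm_nonneg K), hK, norm_hermiteSlice_toLp_sq ω hω, finrank_euclideanSpace,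
      Fintype.card_fin]
  rw [h1, h2, ← h3, mul_comm]
  exact norm_inner_le_norm _ _

end

/-! ### The Bargmann transform on complex lines and its radial majorant. -/

section
open MeasureTheory Filter Topology
open scoped Real ENNReal SchwartzMap

theorem integral_norm_mul_toLp_le {α : Type*} [MeasurableSpace α] {μ : Measure α} {f g : α → ℂ}
    (hf : MemLp f 2 μ) (hg : MemLp g 2 μ) :
    Integrable (fun x => f x * g x) μ ∧
      ∫ x, ‖f x * g x‖ ∂μ ≤ (eLpNorm f 2 μ).toReal * (eLpNorm g 2 μ).toReal := by
  have hint : Integrable (fun x => f x * g x) μ := hf.integrable_mul hg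
  refine ⟨hint, ?_⟩
  have h := eLpNorm_smul_le_mul_eLpNorm (p := 2) (q := 2) (r := 1) hg.1 hf.1
  rw [integral_norm_eq_lintegral_enorm hint.1, ← ENNReal.toReal_mul, ← eLpNorm_one_eq_lintegral_enorm]
  exact ENNReal.toReal_mono (ENNReal.mul_ne_top hf.2.ne hg.2.ne) h

/-- The exponential series at `(2c)²` bounds the square; doubling `c` pays for the geometric factor,
which makes all later sums converge. -/
theorem pow_div_sqrt_factorial_le (c : ℝ) (k : ℕ) :
    c ^ k / √(k.factorial) ≤ Real.exp (2 * c ^ 2) * (1 / 2) ^ k := by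
  have h1 : ((2 * c) ^ 2) ^ k / k.factorial ≤ Real.exp ((2 * c) ^ 2) :=
    Real.pow_div_factorial_le_exp _ (sq_nonneg _) k
  have h2 : (2 * c) ^ k / √(k.factorial) ≤ Real.exp (2 * c ^ 2) := by
    refine le_of_sq_le_sq ?_ (Real.exp_nonneg _)
    rw [div_pow, Real.sq_sqrt (by positivity), ← Real.exp_nat_mul, ← pow_mul, mul_comm k, pow_mul]
    refine h1.trans (le_of_eq ?_)
    congr 1
    push_cast
    ring
  calc c ^ k / √(k.factorial) = (2 * c) ^ k / √(k.factorial) * (1 / 2) ^ k := by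
        rw [mul_pow, div_mul_eq_mul_div, mul_right_comm, ← mul_pow]
        norm_num
    _ ≤ _ := by gcongr

/-- The terms of the radial majorant of the Bargmann transform, with weights `p`. -/
noncomputable def majorantTerm (n : ℕ) (p : ℝ) (k : ℕ) (r : ℝ) : ℝ :=
  p * √(π ^ (n / 2 : ℝ)) * ((√2 * r) ^ k / √(k.factorial))

theorem majorantTerm_eq (n : ℕ) (p : ℝ) (k : ℕ) (r : ℝ) :
    r ^ k / k.factorial * (p * √(π ^ (n / 2 : ℝ) * (2 ^ k * k.factorial))) =
      majorantTerm n p k r := by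
  have h1 : √(k.factorial) ≠ 0 := (Real.sqrt_pos.2 (by positivity)).ne'
  have h2 : (k.factorial : ℝ) = √(k.factorial) * √(k.factorial) :=
    (Real.mul_self_sqrt (by positivity)).symm
  have h3 : √((2 : ℝ) ^ k) = √2 ^ k := by
    rw [Real.sqrt_eq_iff_mul_self_eq (by positivity) (by positivity), ← mul_pow,
      Real.mul_self_sqrt zero_le_two]
  rw [majorantTerm, Real.sqrt_mul (by positivity), Real.sqrt_mul (by positivity), h3]
  rw [mul_pow, div_mul_eq_mul_div, ← mul_div_assoc, div_eq_div_iff (by positivity) h1]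
  linear_combination -(p * √(π ^ (n / 2 : ℝ)) * (√2 ^ k * r ^ k)) * h2

theorem majorantTerm_le (n : ℕ) {p P : ℝ} (hp : 0 ≤ p) (hP : p ≤ P) (k : ℕ) {r R : ℝ} (hr : 0 ≤ r)
    (hR : r ≤ R) : majorantTerm n p k r ≤
      P * √(π ^ (n / 2 : ℝ)) * Real.exp (4 * R ^ 2) * (1 / 2) ^ k := by
  have hP0 := hp.trans hP
  have h := pow_div_sqrt_factorial_le (√2 * R) k
  rw [mul_pow √2 R 2, Real.sq_sqrt zero_le_two, ← mul_assoc, show (2 : ℝ) * 2 = 4 by norm_num] at h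
  unfold majorantTerm
  rw [mul_assoc _ (Real.exp _)]
  refine mul_le_mul (by gcongr) (le_trans ?_ h) (by positivity) (by positivity)
  gcongr

theorem summable_geometric_bound (a : ℝ) : Summable fun k : ℕ => a * (1 / 2 : ℝ) ^ k :=
  (summable_geometric_of_lt_one (by norm_num) (by norm_num)).mul_left a

section
variable {n : ℕ} (f : L2Space n)

/-- The restriction to a complex line of the (rescaled) Bargmann transform. -/
noncomputable def bargmann (ω : RSpace n) (τ : ℂ) : ℂ :=
  ∫ x : RSpace n, f x * ((Real.exp (-‖x‖ ^ 2 / 2) : ℝ) : ℂ) *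
    Complex.exp (2 * (inner ℝ ω x : ℝ) * τ - τ ^ 2)

theorem norm_hermiteProj_le (k : ℕ) : ‖hermiteProj n k f‖ ≤ ‖f‖ :=
  Submodule.norm_starProjection_apply_le _ _

variable {ω : RSpace n}

/-- Termwise integration of the Hermite generating function. The absolute values sit inside the
integral, so domination uses `‖f‖` instead of `‖P_k f‖`. -/
theorem hasSum_bargmann (hω : ‖ω‖ = 1) (τ : ℂ) :
    HasSum (fun k : ℕ => τ ^ k / k.factorial * ∫ x, f x * hermiteSlice ω k x)
      (bargmann f ω τ) := by
  let F : ℕ → RSpace n → ℂ := fun k x => τ ^ k / k.factorial * (f x * hermiteSlice ω k x)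
  have hb := fun k => integral_norm_mul_toLp_le (Lp.memLp f)
    ((hermiteSlice ω k).memLp 2 (volume : Measure (RSpace n)))
  have hF1 : ∀ k, Integrable (F k) := fun k => (hb k).1.const_mul _
  have hle : ∀ k, ∫ x, ‖F k x‖ ≤ ‖f‖ * √(π ^ (n / 2 : ℝ)) * Real.exp (4 * ‖τ‖ ^ 2) * (1 / 2) ^ k := by
    intro k
    have h0 : ‖(hermiteSlice ω k).toLp 2 (volume : Measure (RSpace n))‖ =
        √(π ^ (n / 2 : ℝ) * (2 ^ k * k.factorial)) := by
      rw [← Real.sqrt_sq (norm_nonneg (SchwartzMap.toLp _ _ _)), norm_hermiteSlice_toLp_sq ω hω,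
        finrank_euclideanSpace, Fintype.card_fin]
    have h1 : ∫ x, ‖F k x‖ = ‖τ‖ ^ k / k.factorial * ∫ x, ‖f x * hermiteSlice ω k x‖ := by
      rw [← integral_const_mul]
      simp [F]
    have h2 := (hb k).2
    rw [← Lp.norm_def, ← SchwartzMap.norm_toLp, h0] at h2
    rw [h1]
    refine le_trans ?_ (majorantTerm_le n (norm_nonneg f) le_rfl k (norm_nonneg τ) le_rfl)
    rw [← majorantTerm_eq]
    gcongr
  have hs : Summable fun k => ∫ x, ‖F k x‖ :=
    Summable.of_nonneg_of_le (fun k => by positivity) hle (summable_geometric_bound _)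
  have h := hasSum_integral_of_summable_integral_norm hF1 hs
  have h1 : (fun k => ∫ x, F k x) = fun k : ℕ => τ ^ k / k.factorial *
      ∫ x, f x * hermiteSlice ω k x := by
    funext k
    exact integral_const_mul _ _
  have h2 : ∫ x, ∑' k, F k x = bargmann f ω τ := by
    refine integral_congr_ae (ae_of_all _ fun x => ?_)
    have hx := (hasSum_physHermite (inner ℝ ω x) τ).mul_left
      (f x * ((Real.exp (-‖x‖ ^ 2 / 2) : ℝ) : ℂ))
    simp only
    rw [← hx.tsum_eq]
    refine tsum_congr fun k => ?_
    simp only [F, hermiteSlice_apply, Complex.ofReal_mul]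
    ring
  rwa [h1, h2] at h

theorem norm_bargmann_term_le (hω : ‖ω‖ = 1) (τ : ℂ) (k : ℕ) :
    ‖τ ^ k / k.factorial * ∫ x, f x * hermiteSlice ω k x‖ ≤
      majorantTerm n ‖hermiteProj n k f‖ k ‖τ‖ := by
  rw [← majorantTerm_eq, norm_mul, norm_div, norm_pow, Complex.norm_natCast]
  gcongr
  exact norm_integral_mul_hermiteSlice_le f hω k

/-- The radial majorant of the Bargmann transform. -/
noncomputable def bargmannMajorant (r : ℝ) : ℝ≥0∞ :=
  ∑' k, ENNReal.ofReal (majorantTerm n ‖hermiteProj n k f‖ k r)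

theorem enorm_bargmann_le (hω : ‖ω‖ = 1) (τ : ℂ) :
    ‖bargmann f ω τ‖ₑ ≤ bargmannMajorant f ‖τ‖ := by
  rw [← (hasSum_bargmann f hω τ).tsum_eq]
  refine enorm_tsum_le_tsum_enorm.trans (ENNReal.tsum_le_tsum fun k => ?_)
  rw [← ofReal_norm]
  exact ENNReal.ofReal_le_ofReal (norm_bargmann_term_le f hω τ k)

theorem bargmannMajorant_le {r R : ℝ} (hr : 0 ≤ r) (hR : r ≤ R) :
    bargmannMajorant f r ≤
      ENNReal.ofReal (2 * ‖f‖ * √(π ^ (n / 2 : ℝ)) * Real.exp (4 * R ^ 2)) := by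
  have h : HasSum (fun k : ℕ => ‖f‖ * √(π ^ (n / 2 : ℝ)) * Real.exp (4 * R ^ 2) * (1 / 2) ^ k)
      (2 * ‖f‖ * √(π ^ (n / 2 : ℝ)) * Real.exp (4 * R ^ 2)) := by
    have := hasSum_geometric_two.mul_left (‖f‖ * √(π ^ (n / 2 : ℝ)) * Real.exp (4 * R ^ 2))
    rwa [mul_comm _ (2 : ℝ), ← mul_assoc, ← mul_assoc] at this
  rw [← h.tsum_eq, ENNReal.ofReal_tsum_of_nonneg (fun k => by positivity) h.summable]
  refine ENNReal.tsum_le_tsum fun k => ENNReal.ofReal_le_ofReal ?_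
  exact majorantTerm_le n (norm_nonneg _) (norm_hermiteProj_le f k) k hr hR

theorem measurable_bargmannMajorant : Measurable (bargmannMajorant f) := by
  refine Measurable.tsum fun k => Measurable.ennreal_ofReal ?_
  unfold majorantTerm
  exact Continuous.measurable (by fun_prop)

theorem norm_bargmann_le (hω : ‖ω‖ = 1) (τ : ℂ) :
    ‖bargmann f ω τ‖ ≤ 2 * ‖f‖ * √(π ^ (n / 2 : ℝ)) * Real.exp (4 * ‖τ‖ ^ 2) := by
  have h := (enorm_bargmann_le f hω τ).trans (bargmannMajorant_le f (norm_nonneg τ) le_rfl)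
  rw [← ofReal_norm] at h
  exact (ENNReal.ofReal_le_ofReal_iff (by positivity)).1 h

/-- Weierstrass test: the series is dominated by a geometric one on each disc. -/
theorem differentiable_bargmann (hω : ‖ω‖ = 1) : Differentiable ℂ (bargmann f ω) := by
  have he : bargmann f ω = fun τ => ∑' k : ℕ, τ ^ k / k.factorial *
      ∫ x, f x * hermiteSlice ω k x := funext fun τ => (hasSum_bargmann f hω τ).tsum_eq.symm
  rw [he]
  intro τ
  have hd := Complex.differentiableOn_tsum_of_summable_norm (U := Metric.ball 0 (‖τ‖ + 1))
    (F := fun (k : ℕ) (τ : ℂ) => τ ^ k / k.factorial * ∫ x, f x * hermiteSlice ω k x)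
    (summable_geometric_bound (‖f‖ * √(π ^ (n / 2 : ℝ)) * Real.exp (4 * (‖τ‖ + 1) ^ 2)))
    (fun k => by fun_prop) Metric.isOpen_ball fun k w hw =>
      (norm_bargmann_term_le f hω w k).trans (majorantTerm_le n (norm_nonneg _)
        (norm_hermiteProj_le f k) k (norm_nonneg w) (by simpa using (mem_ball_zero_iff.1 hw).le))
  exact hd.differentiableAt (Metric.isOpen_ball.mem_nhds (by simp))

end

end

/-! ### Integrability from the hypothesis; polar coordinates and Fourier uniqueness. -/

section
open MeasureTheory Filter Topology
open scoped Real ENNReal SchwartzMap FourierTransform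

theorem laguerreFun_twoI_re {n : ℕ} (a k : ℕ) (y : RSpace n) :
    (laguerreFun a k (twoI y)).re = laguerreNeg a k (2 * ‖y‖ ^ 2) * Real.exp (‖y‖ ^ 2) := by
  have hs : ∑ j, twoI y j ^ 2 = ((-(4 * ‖y‖ ^ 2) : ℝ) : ℂ) := by
    rw [EuclideanSpace.real_norm_sq_eq, Finset.mul_sum, ← Finset.sum_neg_distrib]
    push_cast
    refine Finset.sum_congr rfl fun j _ => ?_
    simp only [twoI, mul_pow, Complex.I_sq]
    ring
  have h : laguerreFun a k (twoI y) =
      ((laguerreNeg a k (2 * ‖y‖ ^ 2) * Real.exp (‖y‖ ^ 2) : ℝ) : ℂ) := by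
    rw [laguerreFun, hs, laguerre, laguerreNeg]
    push_cast
    congr 1
    · refine Finset.sum_congr rfl fun i _ => ?_
      rw [show (1 / 2 : ℂ) * (-(4 * (‖y‖ : ℂ) ^ 2)) = (-1) * (2 * (‖y‖ : ℂ) ^ 2) by ring, mul_pow,
        show ∀ b c : ℂ, (-1) ^ i * b * ((-1) ^ i * c) = ((-1) * (-1)) ^ i * (b * c) by
          intro b c; rw [mul_pow]; ring]
      simp
    · congr 1
      ring
  rw [h, Complex.ofReal_re]

theorem ENNReal.le_ofReal_sqrt {x : ℝ≥0∞} {b : ℝ} (hb : 0 ≤ b) (h : x ^ 2 ≤ ENNReal.ofReal b) :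
    x ≤ ENNReal.ofReal √b := by
  by_contra hlt
  have h1 := ENNReal.pow_lt_pow_left two_ne_zero (not_le.1 hlt)
  rw [← ENNReal.ofReal_pow (Real.sqrt_nonneg b), Real.sq_sqrt hb] at h1
  exact absurd h (not_le.2 h1)

section
variable {n : ℕ} (f : L2Space n)

/-- The convolution of `|f| exp (|x|² / 2)` with the Gaussian `exp (-|x|²)`. -/
noncomputable def gaussianConv (u : RSpace n) : ℝ≥0∞ :=
  ∫⁻ x, ‖f x‖ₑ * ENNReal.ofReal (Real.exp (‖x‖ ^ 2 / 2) * Real.exp (-‖x - u‖ ^ 2))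

theorem measurable_gaussianConv_kernel : Measurable (Function.uncurry fun u x : RSpace n =>
    ‖f x‖ₑ * ENNReal.ofReal (Real.exp (‖x‖ ^ 2 / 2) * Real.exp (-‖x - u‖ ^ 2))) :=
  ((Lp.stronglyMeasurable f).measurable.comp measurable_snd).enorm.mul
    (Continuous.measurable (by fun_prop)).ennreal_ofReal

theorem measurable_gaussianConv : Measurable (gaussianConv f) :=
  (measurable_gaussianConv_kernel f).lintegral_prod_right'

/-- For real `r`, `-|x|²/2 + 2r ω·x - r² = |x|²/2 - |x - rω|²`. -/
theorem enorm_bargmann_ofReal_le {ω : RSpace n} (hω : ‖ω‖ = 1) (r : ℝ) :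
    ‖bargmann f ω r‖ₑ ≤ gaussianConv f (r • ω) := by
  refine (enorm_integral_le_lintegral_enorm _).trans (le_of_eq (lintegral_congr fun x => ?_))
  have h1 : Complex.exp (2 * (inner ℝ ω x : ℝ) * r - (r : ℂ) ^ 2) =
      ((Real.exp (2 * inner ℝ ω x * r - r ^ 2) : ℝ) : ℂ) := by push_cast; rfl
  rw [h1, mul_assoc, ← Complex.ofReal_mul, enorm_mul, ← Real.exp_add, ← Real.exp_add]
  congr 1
  rw [← ofReal_norm, Complex.norm_real, Real.norm_of_nonneg (Real.exp_nonneg _)]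
  congr 2
  rw [norm_sub_sq_real, inner_smul_right, norm_smul, hω, real_inner_comm, mul_one,
    Real.norm_eq_abs, sq_abs]
  ring

/-- Integrating in `u` first leaves a Gaussian moment. In its bound `√k!` cancels, and `exp(|x|²/2)`
is the square root of the exponential factor of `φ_k(2ix)`. -/
theorem lintegral_gaussianConv_mul_term_le {a : ℕ} (hn : n = a + 1) (p : ℝ) (hp : 0 ≤ p) (k : ℕ) :
    ∫⁻ u, gaussianConv f u * ENNReal.ofReal (majorantTerm n p k ‖u‖) ≤
      ENNReal.ofReal (√(π ^ (n / 2 : ℝ)) * √(π ^ n)) *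
        ∫⁻ x, ENNReal.ofReal (‖f x‖ * p * √(laguerreFun a k (twoI x)).re) := by
  have hK := measurable_gaussianConv_kernel f
  have hm : Measurable fun u : RSpace n => ENNReal.ofReal (majorantTerm n p k ‖u‖) := by
    unfold majorantTerm
    exact (Continuous.measurable (by fun_prop)).ennreal_ofReal
  unfold gaussianConv
  simp_rw [← lintegral_mul_const' _ _ ENNReal.ofReal_ne_top]
  rw [lintegral_lintegral_swap (hK.mul (hm.comp measurable_fst)).aemeasurable,
    ← lintegral_const_mul' _ _ ENNReal.ofReal_ne_top]
  refine lintegral_mono fun x => ?_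
  simp only
  set c : ℝ := Real.exp (‖x‖ ^ 2 / 2) * (p * √(π ^ (n / 2 : ℝ)) / √(k.factorial)) with hc
  have hc0 : 0 ≤ c := by positivity
  have hL : 0 ≤ laguerreNeg a k (2 * ‖x‖ ^ 2) := laguerreNeg_nonneg a k (by positivity)
  have h1 : ∀ u : RSpace n, ‖f x‖ₑ *
      ENNReal.ofReal (Real.exp (‖x‖ ^ 2 / 2) * Real.exp (-‖x - u‖ ^ 2)) *
        ENNReal.ofReal (majorantTerm n p k ‖u‖) = (‖f x‖ₑ * ENNReal.ofReal c) *
          ENNReal.ofReal ((√2 * ‖u‖) ^ k * Real.exp (-‖x - u‖ ^ 2)) := fun u => by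
    rw [mul_assoc, mul_assoc, ← ENNReal.ofReal_mul (by positivity), ← ENNReal.ofReal_mul hc0, hc,
      majorantTerm]
    congr 2
    ring
  simp_rw [h1]
  rw [lintegral_const_mul' _ _ (ENNReal.mul_ne_top enorm_ne_top ENNReal.ofReal_ne_top)]
  have h2 := ENNReal.le_ofReal_sqrt (by positivity) (sq_lintegral_norm_pow_mul_gaussian_le
    (E := RSpace n) (a := a) (by rw [finrank_euclideanSpace, Fintype.card_fin, hn]) k x)
  refine (mul_le_mul_right h2 _).trans (le_of_eq ?_)
  rw [← ofReal_norm, ← ENNReal.ofReal_mul (norm_nonneg _), ← ENNReal.ofReal_mul (by positivity),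
    ← ENNReal.ofReal_mul (by positivity), laguerreFun_twoI_re, Real.sqrt_mul (by positivity),
    Real.sqrt_mul (by positivity), Real.sqrt_mul hL, ← hn, hc, ← Real.exp_half]
  congr 1
  have h3 : √(k.factorial) ≠ 0 := (Real.sqrt_pos.2 (by positivity)).ne'
  field_simp

theorem lintegral_gaussianConv_mul_majorant_lt_top {a : ℕ} (hn : n = a + 1)
    (h : ∑' k : ℕ, ∫⁻ y : RSpace n, ENNReal.ofReal
      (‖f y‖ * ‖hermiteProj n k f‖ * √(laguerreFun a k (twoI y)).re) < ⊤) :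
    ∫⁻ u, gaussianConv f u * bargmannMajorant f ‖u‖ < ⊤ := by
  have hm : ∀ k, Measurable fun u : RSpace n =>
      gaussianConv f u * ENNReal.ofReal (majorantTerm n ‖hermiteProj n k f‖ k ‖u‖) := fun k => by
    refine (measurable_gaussianConv f).mul ?_
    unfold majorantTerm
    exact (Continuous.measurable (by fun_prop)).ennreal_ofReal
  unfold bargmannMajorant
  simp_rw [← ENNReal.tsum_mul_left]
  rw [lintegral_tsum fun k => (hm k).aemeasurable]
  refine lt_of_le_of_lt (ENNReal.tsum_le_tsum fun k =>
    lintegral_gaussianConv_mul_term_le f hn _ (norm_nonneg _) k) ?_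
  rw [ENNReal.tsum_mul_left]
  exact ENNReal.mul_lt_top ENNReal.ofReal_lt_top h

end

/-- Integration in polar coordinates. -/
theorem lintegral_polar {E : Type*} [NormedAddCommGroup E] [NormedSpace ℝ E] [Nontrivial E]
    [FiniteDimensional ℝ E] [MeasurableSpace E] [BorelSpace E] (μ : Measure E)
    [μ.IsAddHaarMeasure] {h : E → ℝ≥0∞} (hh : Measurable h) :
    ∫⁻ x, h x ∂μ = ∫⁻ ω : Metric.sphere (0 : E) 1, (∫⁻ r in Set.Ioi (0 : ℝ),
      ENNReal.ofReal (r ^ (Module.finrank ℝ E - 1)) * h (r • (ω : E))) ∂μ.toSphere := by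
  have hm : Measurable fun p : Metric.sphere (0 : E) 1 × Set.Ioi (0 : ℝ) =>
      h ((p.2 : ℝ) • (p.1 : E)) :=
    hh.comp (Continuous.measurable (by fun_prop))
  have h1 : ∫⁻ x, h x ∂μ = ∫⁻ p : Metric.sphere (0 : E) 1 × Set.Ioi (0 : ℝ),
      h ((p.2 : ℝ) • (p.1 : E))
        ∂(μ.toSphere.prod (Measure.volumeIoiPow (Module.finrank ℝ E - 1))) := by
    rw [← μ.measurePreserving_homeomorphUnitSphereProd.lintegral_comp hm,
      ← restrict_compl_singleton (μ := μ) (0 : E),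
      ← lintegral_subtype_comap (measurableSet_singleton (0 : E)).compl]
    rw [restrict_compl_singleton]
    refine lintegral_congr fun x => ?_
    congr 1
    have hx : ‖(x : E)‖ ≠ 0 := norm_ne_zero_iff.2 x.2
    simp [smul_smul, hx]
  rw [h1, lintegral_prod _ hm.aemeasurable]
  refine lintegral_congr fun ω => ?_
  have hr : Measurable fun r : Set.Ioi (0 : ℝ) => h ((r : ℝ) • (ω : E)) :=
    hh.comp (Continuous.measurable (by fun_prop))
  rw [Measure.volumeIoiPow, lintegral_withDensity_eq_lintegral_mul _
    (Continuous.measurable (by fun_prop)).ennreal_ofReal hr]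
  exact lintegral_subtype_comap measurableSet_Ioi
    fun r : ℝ => ENNReal.ofReal (r ^ (Module.finrank ℝ E - 1)) * h (r • (ω : E))

/-- Injectivity of the Fourier transform on integrable functions. -/
theorem ae_eq_zero_of_fourier_ae_eq_zero {V : Type*} [NormedAddCommGroup V] [InnerProductSpace ℝ V]
    [FiniteDimensional ℝ V] [MeasurableSpace V] [BorelSpace V] {h : V → ℂ} (hh : Integrable h)
    (h0 : ∀ᵐ v : V, 𝓕 h v = 0) : ∀ᵐ x, h x = 0 := by
  refine ae_eq_zero_of_integral_contDiff_smul_eq_zero hh.locallyIntegrable fun g hg hs => ?_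
  have hg₁ : HasCompactSupport (Complex.ofRealCLM ∘ g) := hs.comp_left rfl
  have hg₂ : ContDiff ℝ ((⊤ : ℕ∞) : WithTop ℕ∞) (Complex.ofRealCLM ∘ g) := by fun_prop
  let ψ : 𝓢(V, ℂ) := hg₁.toSchwartzMap hg₂
  let χ : 𝓢(V, ℂ) := 𝓕⁻ ψ
  have hψ : 𝓕 χ = ψ := FourierTransform.fourier_fourierInv_eq ψ
  -- Each test function is a Fourier transform of a Schwartz function, so duality transfers the
  -- vanishing of `𝓕 h` to `h`.
  have hflip : ∫ ξ, 𝓕 h ξ * χ ξ = ∫ x, h x * (𝓕 (χ : V → ℂ)) x := by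
    simpa using! (VectorFourier.integral_fourierIntegral_smul_eq_flip (L := innerₗ V)
      Real.continuous_fourierChar continuous_inner hh χ.integrable)
  rw [← SchwartzMap.fourier_coe, hψ] at hflip
  calc ∫ x, g x • h x = ∫ x, h x * ψ x := by
        refine integral_congr_ae (ae_of_all _ fun x => ?_)
        change g x • h x = h x * (g x : ℂ)
        rw [Complex.real_smul, mul_comm]
    _ = ∫ ξ, 𝓕 h ξ * χ ξ := hflip.symm
    _ = 0 := by
        refine integral_eq_zero_of_ae ?_
        filter_upwards [h0] with v hv
        simp [hv]

end

/-! ### Conclusion: from almost every direction to `f = 0`. -/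

section
open MeasureTheory Filter Topology
open scoped Real ENNReal SchwartzMap FourierTransform

section
variable {n : ℕ} (f : L2Space n)

/-- At `τ = -iπr` the kernel is the Fourier character at `rω`, up to `exp(-τ²)`. So the Fourier
transform of `f` times the Gaussian vanishes on almost every ray. -/
theorem eq_zero_of_ae_bargmann_eq_zero [Nontrivial (RSpace n)]
    (h : ∀ᵐ ω : Metric.sphere (0 : RSpace n) 1 ∂(volume : Measure (RSpace n)).toSphere, ∀ τ,
      bargmann f (ω : RSpace n) τ = 0) :
    f = 0 := by
  let g : RSpace n → ℂ := fun x => f x * gaussianSchwartz (RSpace n) x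
  have hg : Integrable g := (integral_norm_mul_toLp_le (Lp.memLp f)
    ((gaussianSchwartz (RSpace n)).memLp 2 volume)).1
  have hcont : Continuous (𝓕 g) := VectorFourier.fourierIntegral_continuous
    Real.continuous_fourierChar continuous_inner hg
  have hzero : ∫⁻ v, ‖𝓕 g v‖ₑ = 0 := by
    rw [lintegral_polar volume hcont.measurable.enorm]
    refine (lintegral_congr_ae ?_).trans lintegral_zero
    filter_upwards [h] with ω hω
    refine (lintegral_congr fun r => ?_).trans lintegral_zero
    have hF : 𝓕 g (r • (ω : RSpace n)) = Complex.exp ((-(π * r) * Complex.I) ^ 2) *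
        bargmann f (ω : RSpace n) (-(π * r) * Complex.I) := by
      rw [Real.fourier_eq', bargmann, ← integral_const_mul]
      refine integral_congr_ae (ae_of_all _ fun x => ?_)
      simp only [g, gaussianSchwartz_apply, smul_eq_mul]
      rw [Complex.exp_sub, inner_smul_right, real_inner_comm]
      have he := Complex.exp_ne_zero ((-(π * r) * Complex.I) ^ 2)
      field_simp
      rw [mul_comm (Complex.exp _)]
      congr 2
      push_cast
      ring
    rw [hF, hω]
    simp
  have hae : ∀ᵐ v, 𝓕 g v = 0 := by
    filter_upwards [(lintegral_eq_zero_iff hcont.measurable.enorm).1 hzero] with v hv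
    simpa using hv
  have h0 := ae_eq_zero_of_fourier_ae_eq_zero hg hae
  rw [Lp.eq_zero_iff_ae_eq_zero]
  filter_upwards [h0] with x hx
  have : gaussianSchwartz (RSpace n) x ≠ 0 := by
    rw [gaussianSchwartz_apply, Complex.ofReal_ne_zero]
    exact (Real.exp_pos _).ne'
  exact (mul_eq_zero.1 hx).resolve_right this

variable {f}

/-- This removes the polar weight `r ^ d`: it is at least `1` beyond radius `1`, and below that both
factors are bounded. The sign `s = ±1` selects the half-line. -/
theorem lintegral_ray_ne_top {G : ℂ → ℂ} {m Γ : ℝ → ℝ≥0∞} {M : ℝ≥0∞} (hM : M ≠ ⊤) (s : ℝ)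
    (hG : ∀ r, 0 < r → r ≤ 1 → ‖G ((s * r : ℝ) : ℂ)‖ₑ ≤ M) (hm : ∀ r, 0 < r → r ≤ 1 → m r ≤ M)
    (hΓ : ∀ r, ‖G ((s * r : ℝ) : ℂ)‖ₑ ≤ Γ r) (d : ℕ)
    (hfin : ∫⁻ r in Set.Ioi (0 : ℝ), ENNReal.ofReal (r ^ d) * (Γ r * m r) ≠ ⊤) :
    ∫⁻ r in Set.Ioi (0 : ℝ), ‖G ((s * r : ℝ) : ℂ)‖ₑ * m r ≠ ⊤ := by
  rw [← Set.Ioc_union_Ioi_eq_Ioi zero_le_one,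
    lintegral_union measurableSet_Ioi (Set.Ioc_disjoint_Ioi le_rfl)]
  refine ENNReal.add_ne_top.2 ⟨ne_top_of_le_ne_top (ENNReal.mul_ne_top hM hM) ?_,
    ne_top_of_le_ne_top hfin ?_⟩
  · calc ∫⁻ r in Set.Ioc (0 : ℝ) 1, ‖G ((s * r : ℝ) : ℂ)‖ₑ * m r
        ≤ ∫⁻ _ in Set.Ioc (0 : ℝ) 1, M * M :=
          setLIntegral_mono_ae' measurableSet_Ioc (ae_of_all _ fun r hr =>
            mul_le_mul' (hG r hr.1 hr.2) (hm r hr.1 hr.2))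
      _ = M * M := by simp
  · refine le_trans ?_ (lintegral_mono_set (Set.Ioi_subset_Ioi zero_le_one))
    refine setLIntegral_mono_ae' measurableSet_Ioi (ae_of_all _ fun r hr => ?_)
    have hr1 : (1 : ℝ) ≤ r ^ d := one_le_pow₀ (le_of_lt hr)
    calc ‖G ((s * r : ℝ) : ℂ)‖ₑ * m r ≤ 1 * (Γ r * m r) := by
          rw [one_mul]; exact mul_le_mul_left (hΓ r) _
      _ ≤ _ := by
          gcongr
          rw [← ENNReal.ofReal_one]
          exact ENNReal.ofReal_le_ofReal hr1

/-- **Beurling's theorem for the Hermite operator**. -/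
theorem eq_zero_of_beurling_hermite {a : ℕ} (hn : n = a + 1)
    (h : ∑' k : ℕ, ∫⁻ y : RSpace n, ENNReal.ofReal
      (‖f y‖ * ‖hermiteProj n k f‖ * √(laguerreFun a k (twoI y)).re) < ⊤) : f = 0 := by
  have hdim : Module.finrank ℝ (RSpace n) = n := by rw [finrank_euclideanSpace, Fintype.card_fin]
  have : Nontrivial (RSpace n) := Module.nontrivial_of_finrank_pos (R := ℝ) (by omega)
  have hΓ := measurable_gaussianConv f
  have hM : Measurable fun u : RSpace n => bargmannMajorant f ‖u‖ :=
    (measurable_bargmannMajorant f).comp measurable_norm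
  have hfin := lintegral_gaussianConv_mul_majorant_lt_top f hn h
  -- The reflected integral controls the negative half-line for the same `ω`.
  have hfin' : ∫⁻ u, gaussianConv f (-u) * bargmannMajorant f ‖u‖ < ⊤ := by
    have e := lintegral_neg_eq_self (μ := (volume : Measure (RSpace n)))
      (fun u => gaussianConv f u * bargmannMajorant f ‖u‖)
    simp only [norm_neg] at e
    rwa [e]
  have key : ∀ {Γ : RSpace n → ℝ≥0∞}, Measurable Γ → ∫⁻ u, Γ u * bargmannMajorant f ‖u‖ < ⊤ →
      ∀ᵐ ω : Metric.sphere (0 : RSpace n) 1 ∂(volume : Measure (RSpace n)).toSphere, ∫⁻ r in Set.Ioi (0 : ℝ),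
        ENNReal.ofReal (r ^ (Module.finrank ℝ (RSpace n) - 1)) *
          (Γ (r • (ω : RSpace n)) * bargmannMajorant f r) ≠ ⊤ := fun {Γ} hΓ hlt => by
    rw [lintegral_polar volume (h := fun u => Γ u * bargmannMajorant f ‖u‖) (hΓ.mul hM)] at hlt
    have hmeas : Measurable fun ω : Metric.sphere (0 : RSpace n) 1 =>
        ∫⁻ r in Set.Ioi (0 : ℝ), ENNReal.ofReal (r ^ (Module.finrank ℝ (RSpace n) - 1)) *
          (Γ (r • (ω : RSpace n)) * bargmannMajorant f ‖r • (ω : RSpace n)‖) := by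
      refine Measurable.lintegral_prod_right' (f := fun p : Metric.sphere (0 : RSpace n) 1 × ℝ =>
        ENNReal.ofReal (p.2 ^ (Module.finrank ℝ (RSpace n) - 1)) *
          (Γ (p.2 • (p.1 : RSpace n)) * bargmannMajorant f ‖p.2 • (p.1 : RSpace n)‖)) ?_
      exact (Continuous.measurable (by fun_prop)).ennreal_ofReal.mul
        ((hΓ.mul hM).comp (Continuous.measurable (by fun_prop)))
    filter_upwards [ae_lt_top hmeas hlt.ne] with ω hω
    refine ne_of_eq_of_ne (setLIntegral_congr_fun measurableSet_Ioi fun r hr => ?_) hω.ne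
    have hr' : ‖r • (ω : RSpace n)‖ = r := by
      rw [norm_smul, Real.norm_of_nonneg (le_of_lt hr), norm_eq_of_mem_sphere ω, mul_one]
    simp only [hr']
  refine eq_zero_of_ae_bargmann_eq_zero f ?_
  filter_upwards [key hΓ hfin, key (hΓ.comp measurable_neg) hfin'] with ω h1 h2
  have hω : ‖(ω : RSpace n)‖ = 1 := norm_eq_of_mem_sphere ω
  have hm1 : ∀ r : ℝ, 0 < r → r ≤ 1 → bargmannMajorant f r ≤ _ := fun r h0 h1 =>
    bargmannMajorant_le f h0.le h1
  have hG1 : ∀ s : ℝ, |s| = 1 → ∀ r : ℝ, 0 < r → r ≤ 1 →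
      ‖bargmann f (ω : RSpace n) ((s * r : ℝ) : ℂ)‖ₑ ≤
        ENNReal.ofReal (2 * ‖f‖ * √(π ^ (n / 2 : ℝ)) * Real.exp (4 * 1 ^ 2)) := fun s hs r h0 h1 => by
    refine (enorm_bargmann_le f hω _).trans ?_
    rw [Complex.norm_real, norm_mul, Real.norm_eq_abs, hs, one_mul, Real.norm_of_nonneg h0.le]
    exact hm1 r h0 h1
  have hB : IsBeurling (bargmann f (ω : RSpace n)) (bargmannMajorant f)
      (2 * ‖f‖ * √(π ^ (n / 2 : ℝ))) 4 :=
    { differentiable := differentiable_bargmann f hω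
      growth := norm_bargmann_le f hω
      majorant := enorm_bargmann_le f hω
      integrable_pos := by
        have := lintegral_ray_ne_top ENNReal.ofReal_ne_top 1 (hG1 1 abs_one) hm1 (fun r => by
          have := enorm_bargmann_ofReal_le f hω (1 * r)
          rwa [one_mul] at this ⊢) _ h1
        simpa using this
      integrable_neg := by
        have := lintegral_ray_ne_top ENNReal.ofReal_ne_top (-1) (hG1 (-1) (by simp)) hm1
          (fun r => by
            have := enorm_bargmann_ofReal_le f hω (-1 * r)
            rw [neg_one_mul] at this ⊢
            rwa [neg_smul] at this) _ h2
        simpa using this }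
  exact hB.eq_zero (by norm_num)

end

end

theorem mainTheorem5 (n : ℕ) (hn : 1 ≤ n) :
    ¬ ∃ f : L2Space n, f ≠ 0 ∧
      (∑' k : ℕ, ∫⁻ y : RSpace n,
        ENNReal.ofReal
          (‖f y‖ * ‖hermiteProj n k f‖ * √(laguerreFun (n - 1) k (twoI y)).re)) < ⊤ := by
  rintro ⟨f, hf, h⟩
  exact hf (eq_zero_of_beurling_hermite (by omega) h)
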